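/- **Setting.** Let $m\ge 1$ and let $S$ be a toric Sasaki manifold of dimension $2m-1$: a Riemannian manifold $(S,g)$ whose cone $C(S)=S\times\mathbb R^+$ with the metric $\overline g=r^2g+dr^2$ carries a complex structure $J$ making it a Kähler manifold with Kähler form $\omega=\overline g(J\cdot,\cdot)$, together with an effective action of $T^m$ on $S$ whose extension to $C(S)$ (trivial on $\mathbb R^+$) is holomorphic and isometric. Identify the Lie algebra of $T^m$ with $\mathbb R^m$ by $\exp(v)=(e^{iv^1},\dots,e^{iv^m})$, with integral lattice $\mathbb Z^m$. Let $v(p)=\frac{d}{dt}\big|_{t=0}\exp(tv)\cdot p$ be the vector field generated by $v\in\mathbb R^m$, and assume that the Reeb field $J(r\partial_r)$ is generated by an element $\xi\in\mathbb R^m$. Put $\eta=r^{-2}\overline g(\xi,\cdot)$, let $\mu:C(S)\to(\mathbb R^m)^*$, $\langle\mu(p),v\rangle=\tfrac12r^2\eta(v(p))$, be the moment map, and let $\Delta=\mu(C(S))$. As usual, $C(S)$ is regarded as a toric complex manifold: the $T^m$-action extends to a holomorphic action of $(\mathbb C^\times)^m$ with a free open dense orbit $U_0=(\mathbb C^\times)^m\cdot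 p_0$, on which $(z^1,\dots,z^m)\mapsto(e^{z^1},\dots,e^{z^m})\cdot p_0$ gives logarithmic coordinates; $\sigma:C(S)\to C(S)$ is the antiholomorphic involution with $\sigma(p_0)=p_0$ and $\sigma(w\cdot p)=\overline w\cdot\sigma(p)$; and $\Delta=\{y\mid\langle y,\lambda\rangle\ge0\text{ for all }\lambda\in\Lambda\}\setminus\{0\}$ for a minimal finite set $\Lambda\subset\mathbb Z^m$ of primitive vectors. Write $C(S)^\sigma$ for the fixed point set of $\sigma$. Let $\gamma\in\mathbb Z^m$ satisfy $\langle\gamma,\lambda\rangle=1$ for all $\lambda\in\Lambda$, and let $\Omega_\gamma$ be the nowhere vanishing holomorphic $(m,0)$-form on $C(S)$ which is $\exp(\gamma_1z^1+\dots+\gamma_mz^m)\,dz^1\wedge\dots\wedge dz^m$ on $U_0$. Define $\psi:C(S)\to\mathbb R$ by $$e^{2m\psi}\frac{\omega^m}{m!}=(-1)^{m(m-1)/2}\Big(\frac i2\Big)^m\Omega_\gamma\wedge\overline{\Omega_\gamma}.$$ Let $\zeta\in\mathbb R^m$ and $c\in\mathbb R$ be such that $H_{\zeta,c}=\{y\mid\langle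 y,\zeta\rangle=c\}$ meets the interior of $\Delta$, and $\zeta\notin\mathrm{Span}_{\mathbb R}\{\lambda\in\Lambda\mid\langle y,\lambda\rangle=0\}$ for all $y\in\Delta\cap H_{\zeta,c}$. Let $I\subset\mathbb R$ be an open interval, let $f:I\to\mathbb R$ and $\rho:I\to\mathbb R^+$ be smooth with $\dot f$ nowhere zero, and let $\tau_0=(e^{i\nu^1},\dots,e^{i\nu^m})\in T^m$. Put $$L_{\zeta,c}=\{p\in C(S)^\sigma\mid\langle\mu(p),\zeta\rangle=c\}\times I,\qquad F:L_{\zeta,c}\to C(S),\quad F(p,t)=\rho(t)\cdot\exp(f(t)\zeta)\cdot\tau_0\cdot p,$$ where $\rho\in\mathbb R^+$ acts on $C(S)$ by $\rho\cdot(s,r)=(s,\rho r)$. Put $N=\langle\gamma,\zeta\rangle$, $\theta=\sum_k\gamma_k\nu^k$ and $\kappa(t)=\log\rho(t)$. A Lagrangian submanifold $F:L\to C(S)$ (an immersion of an $m$-dimensional manifold with $F^*\omega=0$) is *special Lagrangian with phase $e^{i\theta_0}$* if its Lagrangian angle $\theta_F:L\to\mathbb R/\pi\mathbb Z$, defined by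 $F^*\Omega_\gamma=e^{i\theta_F+mF^*\psi}\,dV_{F^*\overline g}$ (with $dV$ defined up to sign), is constantly $\theta_0$. **Theorem.** Assume that $\zeta=\xi$, and let $\theta_0\in\mathbb R$. Then $F:L_{\zeta,c}\to C(S)$ is a special Lagrangian submanifold with phase $e^{i\theta_0}$ if and only if the function $$t\mapsto\mathrm{Im}\big(e^{i(\theta-\theta_0)}e^{N(\kappa(t)+if(t))}\big)$$ is constant on $I$. -/

import Mathlib

open scoped Manifold ContDiff

noncomputable section

namespace ToricSasaki

/-! ## The cone over a manifold of dimension `2m - 1` -/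

/-- The model space of a manifold of real dimension `2m - 1`. -/
abbrev SModel (m : ℕ) : Type := EuclideanSpace ℝ (Fin (2 * m - 1))

/-- The positive half line, as an open submanifold of `ℝ`. -/
abbrev PosReal : TopologicalSpace.Opens ℝ := ⟨Set.Ioi 0, isOpen_Ioi⟩

/-- The cone manifold `C(S) = S × ℝ⁺`; the apex is not included. -/
abbrev Cone (S : Type*) : Type _ := S × PosReal

/-- The model with corners of `C(S)`. The tangent space at `(s, r)` is `T_s S × ℝ`. -/
abbrev coneI (m : ℕ) := (𝓘(ℝ, SModel m)).prod 𝓘(ℝ, ℝ)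

section Cone

variable {m : ℕ} {S : Type*} [TopologicalSpace S] [ChartedSpace (SModel m) S]

/-- The `S`-component `dπ(v)` of a tangent vector of the cone. -/
def tangentS {p : Cone S} (v : TangentSpace (coneI m) p) : TangentSpace 𝓘(ℝ, SModel m) p.1 :=
  (show SModel m × ℝ from v).1

/-- The `ℝ⁺`-component `dr(v)` of a tangent vector of the cone. -/
def tangentR {p : Cone S} (v : TangentSpace (coneI m) p) : ℝ :=
  (show SModel m × ℝ from v).2

/-- The position vector `r ∂/∂r` at the point `p = (s, r)`. -/
def position (m : ℕ) {S : Type*} [TopologicalSpace S] [ChartedSpace (SModel m) S]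
    (p : Cone S) : TangentSpace (coneI m) p :=
  show SModel m × ℝ from (0, (p.2 : ℝ))

/-- The action of `ℝ⁺` on the cone, `ρ · (s, r) = (s, ρ r)`. -/
def dilate {S : Type*} (ρ : PosReal) (p : Cone S) : Cone S :=
  (p.1, ⟨(ρ : ℝ) * (p.2 : ℝ), Set.mem_Ioi.mpr (mul_pos (Set.mem_Ioi.mp ρ.2) (Set.mem_Ioi.mp p.2.2))⟩)

/-! ## Complex structures and holomorphic forms -/

/-- The differential of a `ℂᵐ`-valued function on the cone. -/
def dC (φ : Cone S → (Fin m → ℂ)) (q : Cone S) (v : TangentSpace (coneI m) q) : Fin m → ℂ :=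
  mfderiv (coneI m) 𝓘(ℝ, Fin m → ℂ) φ q v

/-- `φ` is a system of local coordinates on the open set `U` that is holomorphic for the
endomorphism field `J`, that is, `dφ ∘ J = i dφ`. -/
structure IsHolomorphicChart
    (J : ∀ p : Cone S, TangentSpace (coneI m) p →L[ℝ] TangentSpace (coneI m) p)
    (U : Set (Cone S)) (φ : Cone S → (Fin m → ℂ)) : Prop where
  isOpen : IsOpen U
  smooth : ContMDiffOn (coneI m) 𝓘(ℝ, Fin m → ℂ) ∞ φ U
  injOn : Set.InjOn φ U
  bijective : ∀ q ∈ U, Function.Bijective (dC φ q)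
  map_J : ∀ q ∈ U, ∀ v, dC φ q (J q v) = Complex.I • dC φ q v

/-- `J` is an (integrable) complex structure: there are holomorphic coordinates around
every point. -/
def IsComplexStructure
    (J : ∀ p : Cone S, TangentSpace (coneI m) p →L[ℝ] TangentSpace (coneI m) p) : Prop :=
  ∀ p : Cone S, ∃ U φ, p ∈ U ∧ IsHolomorphicChart J U φ

/-- `Ω` is a nowhere vanishing holomorphic `(m, 0)`-form: around every point it can be written
as `h dw¹ ∧ ⋯ ∧ dwᵐ` with holomorphic coordinates `w = φ` and a holomorphic function `h`
without zeros. -/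
def IsHolomorphicVolumeForm
    (J : ∀ p : Cone S, TangentSpace (coneI m) p →L[ℝ] TangentSpace (coneI m) p)
    (Ω : ∀ p : Cone S, TangentSpace (coneI m) p [⋀^Fin m]→ₗ[ℝ] ℂ) : Prop :=
  ∀ p : Cone S, ∃ U φ, p ∈ U ∧ IsHolomorphicChart J U φ ∧
    ∃ h : (Fin m → ℂ) → ℂ, DifferentiableOn ℂ h (φ '' U) ∧
      ∀ q ∈ U, h (φ q) ≠ 0 ∧
        ∀ v : Fin m → TangentSpace (coneI m) q,
          Ω q v = h (φ q) * Matrix.det (Matrix.of fun j k => dC φ q (v j) k)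

/-- A `2`-form `α` on the cone is closed: `dω = 0` holds in all local coordinates. Coordinates
are given by local diffeomorphisms `Φ` from open sets `V` of the real vector space `ℂᵐ`; in them
the exterior derivative of `Φ^* α`, evaluated on constant vector fields, is a cyclic sum. -/
def IsClosedTwoForm (α : ∀ p : Cone S, TangentSpace (coneI m) p → TangentSpace (coneI m) p → ℝ) :
    Prop :=
  ∀ (V : Set (Fin m → ℂ)) (Φ : (Fin m → ℂ) → Cone S), IsOpen V →
    ContMDiffOn 𝓘(ℝ, Fin m → ℂ) (coneI m) ∞ Φ V →
    (∀ x ∈ V, Function.Bijective (mfderiv 𝓘(ℝ, Fin m → ℂ) (coneI m) Φ x)) →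
    let pull : (Fin m → ℂ) → (Fin m → ℂ) → (Fin m → ℂ) → ℝ := fun x v w =>
      α (Φ x) (mfderiv 𝓘(ℝ, Fin m → ℂ) (coneI m) Φ x v)
        (mfderiv 𝓘(ℝ, Fin m → ℂ) (coneI m) Φ x w)
    ∀ x ∈ V, ∀ u v w : Fin m → ℂ,
      fderiv ℝ (fun y => pull y v w) x u + fderiv ℝ (fun y => pull y w u) x v
        + fderiv ℝ (fun y => pull y u v) x w = 0

end Cone

/-! ## Sasaki manifolds -/

/-- The cone metric `r² g + dr²`. -/
def coneMetric {m : ℕ} {S : Type*} [TopologicalSpace S] [ChartedSpace (SModel m) S]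
    [IsManifold 𝓘(ℝ, SModel m) ∞ S]
    (g : Bundle.ContMDiffRiemannianMetric 𝓘(ℝ, SModel m) ∞ (SModel m)
      (fun x : S => TangentSpace 𝓘(ℝ, SModel m) x))
    (p : Cone S) (v w : TangentSpace (coneI m) p) : ℝ :=
  (p.2 : ℝ) ^ 2 * g.inner p.1 (tangentS v) (tangentS w) + tangentR v * tangentR w

/-- A Sasaki manifold of dimension `2m - 1`: a Riemannian manifold `(S, g)` with a complex
structure `J` on `C(S)` such that `(C(S), r² g + dr², J)` is a Kähler manifold. -/
structure SasakiManifold (m : ℕ) (S : Type*) [TopologicalSpace S] [ChartedSpace (SModel m) S]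
    [IsManifold 𝓘(ℝ, SModel m) ∞ S] where
  g : Bundle.ContMDiffRiemannianMetric 𝓘(ℝ, SModel m) ∞ (SModel m)
    (fun x : S => TangentSpace 𝓘(ℝ, SModel m) x)
  J : ∀ p : Cone S, TangentSpace (coneI m) p →L[ℝ] TangentSpace (coneI m) p
  isComplexStructure : IsComplexStructure J
  compatible : ∀ (p : Cone S) (v w : TangentSpace (coneI m) p),
    coneMetric g p (J p v) (J p w) = coneMetric g p v w
  closed : IsClosedTwoForm fun p v w => coneMetric g p (J p v) w

namespace SasakiManifold

variable {m : ℕ} {S : Type*} [TopologicalSpace S] [ChartedSpace (SModel m) S]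
  [IsManifold 𝓘(ℝ, SModel m) ∞ S]

/-- The cone metric. -/
def metric (X : SasakiManifold m S) (p : Cone S) (v w : TangentSpace (coneI m) p) : ℝ :=
  coneMetric X.g p v w

/-- The Kähler form `ω(v, w) = ḡ(J v, w)`. -/
def kahlerForm (X : SasakiManifold m S) (p : Cone S) (v w : TangentSpace (coneI m) p) : ℝ :=
  X.metric p (X.J p v) w

/-- The Reeb field `ξ = J (r ∂/∂r)` on the cone. -/
def reebField (X : SasakiManifold m S) (p : Cone S) : TangentSpace (coneI m) p :=
  X.J p (position m p)

/-- The contact form `η = r⁻² ḡ(ξ, ·)` on the cone. -/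
def contactForm (X : SasakiManifold m S) (p : Cone S) (v : TangentSpace (coneI m) p) : ℝ :=
  1 / (p.2 : ℝ) ^ 2 * X.metric p (X.reebField p) v

end SasakiManifold

/-! ## Toric Sasaki manifolds -/

/-- The exponential map `v ↦ (e^{i v₁}, …, e^{i vₘ})` of the torus `Tᵐ`, whose Lie algebra is
`ℝᵐ`. The lattice of `ℝᵐ` is `ℤᵐ`; `2π ℤᵐ` is the kernel of this map. -/
def expT {m : ℕ} (v : Fin m → ℝ) : Fin m → Circle := fun k => Circle.exp (v k)

/-- The exponential map `z ↦ (e^{z₁}, …, e^{zₘ})` of the complex torus `(ℂˣ)ᵐ`. -/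
def expC {m : ℕ} (z : Fin m → ℂ) : Fin m → ℂˣ :=
  fun k => Units.mk0 (Complex.exp (z k)) (Complex.exp_ne_zero (z k))

/-- The action on the cone that is induced by an action on `S`. -/
def torusAct {m : ℕ} {S : Type*} (T : (Fin m → Circle) →* Equiv.Perm S) (τ : Fin m → Circle)
    (p : Cone S) : Cone S :=
  (T τ p.1, p.2)

/-- The vector field on the cone generated by `v`, an element of the Lie algebra of `Tᵐ`. -/
def fundamentalField {m : ℕ} {S : Type*} [TopologicalSpace S] [ChartedSpace (SModel m) S]
    (T : (Fin m → Circle) →* Equiv.Perm S) (v : Fin m → ℝ) (p : Cone S) :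
    TangentSpace (coneI m) p :=
  show SModel m × ℝ from
    mfderiv 𝓘(ℝ, ℝ) (coneI m) (fun t : ℝ => torusAct T (expT (t • v)) p) 0 (1 : ℝ)

/-- A toric Sasaki manifold of dimension `2m - 1` whose Reeb field is generated by an element
`reeb` of the Lie algebra of the torus. -/
structure ToricSasakiManifold (m : ℕ) (S : Type*) [TopologicalSpace S]
    [ChartedSpace (SModel m) S] [IsManifold 𝓘(ℝ, SModel m) ∞ S] extends SasakiManifold m S where
  /-- the action of `Tᵐ` on `S` -/
  T : (Fin m → Circle) →* Equiv.Perm S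
  smooth_T : ContMDiff ((𝓘(ℝ, Fin m → ℝ)).prod 𝓘(ℝ, SModel m)) 𝓘(ℝ, SModel m) ∞
    (fun x : (Fin m → ℝ) × S => T (expT x.1) x.2)
  effective_T : Function.Injective T
  holomorphic_T : ∀ τ (p : Cone S) (v : TangentSpace (coneI m) p),
    mfderiv (coneI m) (coneI m) (torusAct T τ) p (J p v)
      = J (torusAct T τ p) (mfderiv (coneI m) (coneI m) (torusAct T τ) p v)
  isometric_T : ∀ τ (p : Cone S) (v w : TangentSpace (coneI m) p),
    coneMetric g (torusAct T τ p) (mfderiv (coneI m) (coneI m) (torusAct T τ) p v)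
      (mfderiv (coneI m) (coneI m) (torusAct T τ) p w) = coneMetric g p v w
  /-- the element of the Lie algebra that generates the Reeb field -/
  reeb : Fin m → ℝ
  reeb_generates : ∀ p : Cone S, fundamentalField T reeb p = J p (position m p)

namespace ToricSasakiManifold

variable {m : ℕ} {S : Type*} [TopologicalSpace S] [ChartedSpace (SModel m) S]
  [IsManifold 𝓘(ℝ, SModel m) ∞ S]

/-- The moment map `⟨μ(p), v⟩ = r² η(v(p)) / 2`; its components are the values on the standard
basis of the Lie algebra `ℝᵐ`. -/
def moment (X : ToricSasakiManifold m S) (p : Cone S) : Fin m → ℝ := fun k =>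
  1 / 2 * (p.2 : ℝ) ^ 2 *
    X.toSasakiManifold.contactForm p (fundamentalField X.T (Pi.single k 1) p)

/-- The moment image `Δ = μ(C(S))`. -/
def momentImage (X : ToricSasakiManifold m S) : Set (Fin m → ℝ) := Set.range X.moment

end ToricSasakiManifold

/-- The pairing of the dual of the Lie algebra with the Lie algebra. -/
def pairing {m : ℕ} (y v : Fin m → ℝ) : ℝ := ∑ k, y k * v k

/-- A lattice vector, as an element of the Lie algebra (or of its dual). -/
def ofLattice {m : ℕ} (a : Fin m → ℤ) : Fin m → ℝ := fun k => (a k : ℝ)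

/-- `Λ` is the set of primitive inward conormals of the rational polyhedral cone `Δ`: a minimal
finite set of primitive lattice vectors with
`Δ = {y | ⟨y, l⟩ ≥ 0 for all l ∈ Λ} - {0}`. -/
structure IsConormalSet {m : ℕ} (Λ : Set (Fin m → ℤ)) (Δ : Set (Fin m → ℝ)) : Prop where
  finite : Λ.Finite
  primitive : ∀ l ∈ Λ, ∀ (n : ℤ) (a : Fin m → ℤ), l = n • a → IsUnit n
  eq : Δ = {y | ∀ l ∈ Λ, 0 ≤ pairing y (ofLattice l)} \ {0}
  minimal : ∀ Λ' ⊂ Λ, Δ ≠ {y | ∀ l ∈ Λ', 0 ≤ pairing y (ofLattice l)} \ {0}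

/-- The space `𝔷_y` spanned by the conormals that vanish at `y`. -/
def conormalSpan {m : ℕ} (Λ : Set (Fin m → ℤ)) (y : Fin m → ℝ) : Submodule ℝ (Fin m → ℝ) :=
  Submodule.span ℝ (ofLattice '' {l ∈ Λ | pairing y (ofLattice l) = 0})

/-- The structure of a toric complex manifold on the cone: the holomorphic action of the complex
torus `(ℂˣ)ᵐ` that extends the action of `Tᵐ`, a base point that identifies its open dense orbit
with `(ℂˣ)ᵐ`, and the antiholomorphic involution that is the complex conjugation on this orbit. -/
structure ToricCone {m : ℕ} {S : Type*} [TopologicalSpace S] [ChartedSpace (SModel m) S]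
    [IsManifold 𝓘(ℝ, SModel m) ∞ S] (X : ToricSasakiManifold m S) where
  /-- the action of the complex torus -/
  act : (Fin m → ℂˣ) →* Equiv.Perm (Cone S)
  act_torus : ∀ (τ : Fin m → Circle) (p : Cone S),
    act (fun k => Circle.toUnits (τ k)) p = torusAct X.T τ p
  smooth_act : ContMDiff ((𝓘(ℝ, Fin m → ℂ)).prod (coneI m)) (coneI m) ∞
    (fun x : (Fin m → ℂ) × Cone S => act (expC x.1) x.2)
  /-- the action is holomorphic, in the torus variable and in the point -/
  holomorphic_act : ∀ (z : Fin m → ℂ) (p : Cone S) (u : Fin m → ℂ) (v : TangentSpace (coneI m) p),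
    mfderiv ((𝓘(ℝ, Fin m → ℂ)).prod (coneI m)) (coneI m)
        (fun x : (Fin m → ℂ) × Cone S => act (expC x.1) x.2) (z, p) (Complex.I • u, X.J p v)
      = X.J (act (expC z) p) (mfderiv ((𝓘(ℝ, Fin m → ℂ)).prod (coneI m)) (coneI m)
        (fun x : (Fin m → ℂ) × Cone S => act (expC x.1) x.2) (z, p) (u, v))
  /-- the point of the open orbit that corresponds to `1 ∈ (ℂˣ)ᵐ` -/
  base : Cone S
  free_base : Function.Injective fun w => act w base
  isOpen_orbit : IsOpen (Set.range fun w => act w base)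
  dense_orbit : Dense (Set.range fun w => act w base)
  /-- the antiholomorphic involution -/
  σ : Cone S → Cone S
  smooth_σ : ContMDiff (coneI m) (coneI m) ∞ σ
  involutive_σ : Function.Involutive σ
  antiholomorphic_σ : ∀ (p : Cone S) (v : TangentSpace (coneI m) p),
    mfderiv (coneI m) (coneI m) σ p (X.J p v)
      = -X.J (σ p) (mfderiv (coneI m) (coneI m) σ p v)
  σ_act : ∀ (w : Fin m → ℂˣ) (p : Cone S), σ (act w p) = act (star w) (σ p)
  σ_base : σ base = base

namespace ToricCone

variable {m : ℕ} {S : Type*} [TopologicalSpace S] [ChartedSpace (SModel m) S]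
  [IsManifold 𝓘(ℝ, SModel m) ∞ S] {X : ToricSasakiManifold m S}

/-- The logarithmic holomorphic coordinates, as a map from `ℂᵐ` onto the open orbit. -/
def logParam (Y : ToricCone X) (z : Fin m → ℂ) : Cone S := Y.act (expC z) Y.base

/-- `Ω` is the holomorphic `(m, 0)`-form `Ω_γ`: it is holomorphic without zeros on `C(S)`, and it is
`exp(γ₁ z¹ + ⋯ + γₘ zᵐ) dz¹ ∧ ⋯ ∧ dzᵐ` in the logarithmic coordinates of the open orbit. -/
def IsCanonicalForm (Y : ToricCone X) (γ : Fin m → ℤ)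
    (Ω : ∀ p : Cone S, TangentSpace (coneI m) p [⋀^Fin m]→ₗ[ℝ] ℂ) : Prop :=
  IsHolomorphicVolumeForm X.J Ω ∧
    ∀ (z : Fin m → ℂ) (v : Fin m → (Fin m → ℂ)),
      Ω (Y.logParam z)
          (fun j => mfderiv 𝓘(ℝ, Fin m → ℂ) (coneI m) Y.logParam z (v j))
        = Complex.exp (∑ k, (γ k : ℂ) * z k) * Matrix.det (Matrix.of v)

/-- The real form `C(S)^σ`. -/
def realForm (Y : ToricCone X) : Set (Cone S) := {p | Y.σ p = p}

/-- The set `C(S)^σ_{ζ,c} = {p ∈ C(S)^σ | ⟨μ(p), ζ⟩ = c}`. -/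
def realLevel (Y : ToricCone X) (ζ : Fin m → ℝ) (c : ℝ) : Set (Cone S) :=
  {p ∈ Y.realForm | pairing (X.moment p) ζ = c}

/-- The manifold `L_{ζ,c} = C(S)^σ_{ζ,c} × I`, as a subset of `C(S) × ℝ`. -/
def lagDomain (Y : ToricCone X) (ζ : Fin m → ℝ) (c : ℝ) (I : Set ℝ) : Set (Cone S × ℝ) :=
  Y.realLevel ζ c ×ˢ I

end ToricCone

/-- The map `F(p, t) = ρ(t) · τ(t) · p` with `τ(t) = exp(f(t) ζ) · τ₀`. -/
def lagMap {m : ℕ} {S : Type*} [TopologicalSpace S] [ChartedSpace (SModel m) S]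
    [IsManifold 𝓘(ℝ, SModel m) ∞ S] (X : ToricSasakiManifold m S) (ζ : Fin m → ℝ)
    (τ₀ : Fin m → Circle) (f : ℝ → ℝ) (ρ : ℝ → PosReal) (x : Cone S × ℝ) : Cone S :=
  dilate (ρ x.2) (torusAct X.T (expT (f x.2 • ζ) * τ₀) x.1)

/-! ## Special Lagrangian submanifolds -/

/-- `v` is tangent at `x` to the subset `L` of a manifold `P`: it is the velocity at `x` of a
smooth curve that lies in `L`. For a submanifold `L` these vectors form its tangent space. -/
def IsTangentTo {E H P : Type*} [NormedAddCommGroup E] [NormedSpace ℝ E] [TopologicalSpace H]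
    (I : ModelWithCorners ℝ E H) [TopologicalSpace P] [ChartedSpace H P]
    (L : Set P) (x : P) (v : TangentSpace I x) : Prop :=
  ∃ ε > (0 : ℝ), ∃ c : ℝ → P, ContMDiffOn 𝓘(ℝ, ℝ) I ∞ c (Set.Ioo (-ε) ε) ∧
    (∀ s ∈ Set.Ioo (-ε) ε, c s ∈ L) ∧ c 0 = x ∧
    (show E from mfderiv 𝓘(ℝ, ℝ) I c 0 (1 : ℝ)) = (show E from v)

section SpecialLagrangian

variable {m : ℕ} {S : Type*} [TopologicalSpace S] [ChartedSpace (SModel m) S]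
  [IsManifold 𝓘(ℝ, SModel m) ∞ S]

/-- The model with corners of `C(S) × ℝ`. -/
abbrev coneLineI (m : ℕ) := (coneI m).prod 𝓘(ℝ, ℝ)

/-- `ψ` is the function defined by
`e^{2mψ} ω^m / m! = (-1)^{m(m-1)/2} (i/2)^m Ω ∧ conj Ω`. Evaluated on
`(v₁, J v₁, …, vₘ, J vₘ)`, the form `ω^m / m!` is the determinant of the Hermitian matrix of the
`ḡ(vⱼ, vₖ) - i ω(vⱼ, vₖ)` and the right hand side is `|Ω(v₁, …, vₘ)|²`. -/
def IsVolumeRatio (X : SasakiManifold m S)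
    (Ω : ∀ p : Cone S, TangentSpace (coneI m) p [⋀^Fin m]→ₗ[ℝ] ℂ) (ψ : Cone S → ℝ) : Prop :=
  ∀ (p : Cone S) (v : Fin m → TangentSpace (coneI m) p),
    (Real.exp (2 * m * ψ p) : ℂ) *
        Matrix.det (Matrix.of fun j k =>
          (X.metric p (v j) (v k) : ℂ) - Complex.I * (X.kahlerForm p (v j) (v k) : ℂ))
      = ((‖Ω p v‖ ^ 2 : ℝ) : ℂ)

/-- The restriction of `F : C(S) × ℝ → C(S)` to the subset `L` is a Lagrangian submanifold: `L` has
an `m`-dimensional tangent space at each of its points, and `F` is smooth, an immersion of `L`, and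
satisfies `F^* ω = 0` on `L`. -/
def IsLagrangian (X : SasakiManifold m S) (L : Set (Cone S × ℝ)) (F : Cone S × ℝ → Cone S) :
    Prop :=
  ∀ x ∈ L,
    (∃ V : Submodule ℝ (TangentSpace (coneLineI m) x), Module.finrank ℝ V = m ∧
      ∀ v, v ∈ V ↔ IsTangentTo (coneLineI m) L x v) ∧
    ContMDiffAt (coneLineI m) (coneI m) ∞ F x ∧
    (∀ v, IsTangentTo (coneLineI m) L x v →
      mfderiv (coneLineI m) (coneI m) F x v = 0 → v = 0) ∧
    ∀ v w, IsTangentTo (coneLineI m) L x v → IsTangentTo (coneLineI m) L x w →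
      X.kahlerForm (F x) (mfderiv (coneLineI m) (coneI m) F x v)
        (mfderiv (coneLineI m) (coneI m) F x w) = 0

/-- The Lagrangian angle of `F` on `L` at `x` is `θ` modulo `π`: the form `F^* Ω` on the tangent
space of `L` is `e^{iθ + m ψ(F(x))} dV`, where `dV` is the Riemannian volume form of the induced
metric (the square root of the Gram determinant), which is defined up to sign. -/
def HasLagrangianAngle (X : SasakiManifold m S)
    (Ω : ∀ p : Cone S, TangentSpace (coneI m) p [⋀^Fin m]→ₗ[ℝ] ℂ) (ψ : Cone S → ℝ)
    (L : Set (Cone S × ℝ)) (F : Cone S × ℝ → Cone S) (x : Cone S × ℝ) (θ : ℝ) : Prop :=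
  ∀ v : Fin m → TangentSpace (coneLineI m) x, (∀ j, IsTangentTo (coneLineI m) L x (v j)) →
    ∃ ε : ℂ, (ε = 1 ∨ ε = -1) ∧
      Ω (F x) (fun j => mfderiv (coneLineI m) (coneI m) F x (v j))
        = ε * Complex.exp (Complex.I * θ + m * ψ (F x)) *
          (Real.sqrt (Matrix.det (Matrix.of fun j k =>
            X.metric (F x) (mfderiv (coneLineI m) (coneI m) F x (v j))
              (mfderiv (coneLineI m) (coneI m) F x (v k)))) : ℂ)

/-- `F : L → C(S)` is a special Lagrangian submanifold with phase `e^{iθ}`: a Lagrangian submanifold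
whose Lagrangian angle is constantly `θ` (in `ℝ / πℤ`). -/
def IsSpecialLagrangian (X : SasakiManifold m S)
    (Ω : ∀ p : Cone S, TangentSpace (coneI m) p [⋀^Fin m]→ₗ[ℝ] ℂ) (ψ : Cone S → ℝ)
    (L : Set (Cone S × ℝ)) (F : Cone S × ℝ → Cone S) (θ : ℝ) : Prop :=
  IsLagrangian X L F ∧ ∀ x ∈ L, HasLagrangianAngle X Ω ψ L F x θ

end SpecialLagrangian

end ToricSasaki

end

/-! For ζ = ξ the function ⟨μ, ζ⟩ is r²/2, and the real element exp(s ξ) of the complex torus acts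
as the dilation by e^s. So L is the intersection of the real form with a sphere, times I, and F
translates p by the torus element with logarithm log ρ · ξ + i(f ξ + ν). This translation is a
homothety, commutes with J and multiplies Ω by the exponential of γ paired with that logarithm. Up
to its derivative, dF sends (u, a) to u + a(κ' r∂ᵣ + f' J r∂ᵣ), where u is tangent to the real form
and to the sphere (`mfderiv_lagMap`).

The map is Lagrangian without any condition on the phase (`isLagrangian_lagMap`): the real form is
isotropic, because σ is antiholomorphic and isometric, and ω(u, J r∂ᵣ) = r dr(u) = 0. That σ is
isometric has to be proved (`coneMetric_σ`). On the open orbit it follows from the isotropy of the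
torus orbits, which comes from dω = 0 together with the invariance of ω under the torus and its
homogeneity under dilations; density of the orbit gives the rest.

For the phase, m tangent vectors have components u_j in a space of dimension m - 1, so they satisfy
a linear relation, and this makes Ω(u_j + a_j β r∂ᵣ) equal to β Ω(u_j + a_j r∂ᵣ) with β = κ' + i f'.
The last value of Ω is real. Hence e^{-iθ₀} F^*Ω is a real multiple of Z β, with Z = e^{i(θ - θ₀)}
e^{N(κ + i f)}. The definition of ψ already fixes the modulus of F^*Ω, so the angle is θ₀ exactly
when Im(Z β) = 0. Finally (Im Z)' = N Im(Z β), and N > 0 because γ lies in Δ, where the pairing with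
ξ is positive (`pairing_reeb_pos`). -/

namespace ToricSasaki

open Topology Set Bundle

/-! ### Linear relations in determinants, and curves of fixed points of an involution -/

/-- If the rows `A j` satisfy a nontrivial linear relation, then the determinant of the rows
`A j + a j β e` depends linearly on `β`. -/
theorem det_add_smul_of_relation {R : Type*} [Field R] {m : ℕ} (A : Fin m → Fin m → R)
    (a : Fin m → R) (e : Fin m → R) (c : Fin m → R) {i : Fin m} (hi : c i ≠ 0)
    (hc : ∑ j, c j • A j = 0) (β : R) :
    Matrix.det (Matrix.of fun j => A j + (a j * β) • e)
      = β * Matrix.det (Matrix.of fun j => A j + a j • e) := by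
  -- Row operations with the coefficients `c` turn row `i` into a multiple of `e`, since the `A`
  -- part cancels. Once row `i` is `e`, the `e` terms of the other rows can be removed, and `b`
  -- survives only as a factor.
  have key : ∀ b : R, c i * Matrix.det (Matrix.of fun j => A j + (a j * b) • e)
      = (∑ j, c j * a j) * b * Matrix.det (Matrix.updateRow (Matrix.of A) i e) := by
    intro b
    have h := Matrix.det_updateRow_sum (Matrix.of fun j => A j + (a j * b) • e) i c
    rw [smul_eq_mul] at h
    rw [← h]
    have hsum : (∑ k, c k • (Matrix.of fun j => A j + (a j * b) • e) k)
        = ((∑ j, c j * a j) * b) • e := by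
      have : ∀ k, c k • (Matrix.of fun j => A j + (a j * b) • e) k
          = c k • A k + (c k * a k * b) • e := by
        intro k
        ext l
        simp [Matrix.of_apply]
        ring
      rw [Finset.sum_congr rfl fun k _ => this k, Finset.sum_add_distrib, hc, zero_add,
        ← Finset.sum_smul, Finset.sum_mul]
    rw [hsum, Matrix.det_updateRow_smul]
    congr 1
    refine Matrix.det_eq_of_forall_row_eq_smul_add_const
      (fun j => if j = i then 0 else a j * b) i (by simp) ?_
    intro j l
    by_cases hj : j = i
    · subst hj; simp
    · simp [Matrix.updateRow_apply, hj]
  have h1 := key β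
  have h2 := key 1
  simp only [mul_one] at h2
  apply mul_left_cancel₀ hi
  rw [h1, mul_left_comm, h2]
  ring

/-- Through a fixed point of a smooth involution there is a smooth curve of fixed points with any
given velocity that is fixed by the derivative. -/
theorem exists_curve_of_fixedPoints {E : Type*} [NormedAddCommGroup E] [NormedSpace ℝ E]
    [CompleteSpace E] {s : E → E} {U : Set E} (hU : IsOpen U) {x₀ : E} (hx₀ : x₀ ∈ U)
    (hs : ContDiffOn ℝ ∞ s U) (hfix : s x₀ = x₀) (hinv : ∀ᶠ x in 𝓝 x₀, s (s x) = x) {v : E}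
    (hv : fderiv ℝ s x₀ v = v) :
    ∃ ε > (0 : ℝ), ∃ y : ℝ → E, ContDiffOn ℝ ∞ y (Ioo (-ε) ε) ∧ y 0 = x₀ ∧
      (∀ τ ∈ Ioo (-ε) ε, y τ ∈ U ∧ s (y τ) = y τ) ∧ HasDerivAt y v 0 := by
  have hsAt : ∀ x ∈ U, ContDiffAt ℝ ∞ s x := fun x hx => hs.contDiffAt (hU.mem_nhds hx)
  have hsd : HasFDerivAt s (fderiv ℝ s x₀) x₀ :=
    ((hsAt x₀ hx₀).differentiableAt (by simp)).hasFDerivAt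
  set A := fderiv ℝ s x₀ with hA
  have hAA : A.comp A = ContinuousLinearMap.id ℝ E := by
    have h1 : HasFDerivAt (fun x => s (s x)) (A.comp A) x₀ :=
      HasFDerivAt.comp x₀ (by rw [hfix]; exact hsd) hsd
    have h2 : HasFDerivAt (fun x => s (s x)) (ContinuousLinearMap.id ℝ E) x₀ :=
      (hasFDerivAt_id x₀).congr_of_eventuallyEq hinv
    exact h1.unique h2
  have hAA' : ∀ x, A (A x) = x := fun x => by
    simpa using congrArg (fun B : E →L[ℝ] E => B x) hAA
  -- Averaging over the group {1, s} linearizes the involution: `h` has derivative the identity at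
  -- `x₀` and satisfies `h ∘ s = A ∘ h` near it. It is thus a local diffeomorphism matching fixed
  -- points of `s` with fixed vectors of `A`.
  let h : E → E := fun x => (1 / 2 : ℝ) • (x + A (s x))
  have hh : ∀ x ∈ U, ContDiffAt ℝ ∞ h x := fun x hx =>
    contDiffAt_const.smul (contDiffAt_id.add (A.contDiff.contDiffAt.comp x (hsAt x hx)))
  have hhd : HasFDerivAt h (ContinuousLinearMap.id ℝ E) x₀ := by
    have h1 : HasFDerivAt h ((1 / 2 : ℝ) • (ContinuousLinearMap.id ℝ E + A.comp A)) x₀ :=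
      ((hasFDerivAt_id x₀).add (A.hasFDerivAt.comp x₀ hsd)).const_smul (1 / 2 : ℝ)
    convert h1 using 1
    rw [hAA]
    ext x
    simp only [ContinuousLinearMap.id_apply, smul_apply,
      add_apply, ← two_smul ℝ x, smul_smul]
    norm_num
  have hconj : ∀ x, s (s x) = x → h (s x) = A (h x) := by
    intro x hx
    simp only [h, hx, map_smul, map_add, hAA']
    rw [add_comm]
  have hAh : A (h x₀) = h x₀ := by
    rw [← hconj x₀ (by rw [hfix, hfix]), hfix]
  have hhd' : HasFDerivAt h ((ContinuousLinearEquiv.refl ℝ E : E ≃L[ℝ] E) : E →L[ℝ] E) x₀ := hhd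
  let e := (hh x₀ hx₀).toOpenPartialHomeomorph h hhd' (by simp)
  have he : ∀ x, e x = h x := fun x => rfl
  have hxe : x₀ ∈ e.source := (hh x₀ hx₀).mem_toOpenPartialHomeomorph_source hhd' (by simp)
  have hcont : ContinuousAt (fderiv ℝ h) x₀ :=
    ((hh x₀ hx₀).fderiv_right (m := 0) (by simp)).continuousAt
  -- Smoothness of the local inverse at nearby points, not only at `e x₀`, needs an invertible
  -- derivative there; invertible operators form an open set.
  have hinvertible : ∀ᶠ x in 𝓝 x₀, ∃ B : E ≃L[ℝ] E, (B : E →L[ℝ] E) = fderiv ℝ h x := by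
    have : range ((↑) : (E ≃L[ℝ] E) → E →L[ℝ] E) ∈ 𝓝 (fderiv ℝ h x₀) := by
      rw [hhd'.fderiv]
      exact ContinuousLinearEquiv.nhds _
    exact hcont this
  have hgood : ∀ᶠ x in 𝓝 x₀, x ∈ U ∧ x ∈ e.source ∧ s x ∈ e.source ∧ s (s x) = x ∧
      ∃ B : E ≃L[ℝ] E, (B : E →L[ℝ] E) = fderiv ℝ h x := by
    filter_upwards [hU.mem_nhds hx₀, e.open_source.mem_nhds hxe,
      hsd.continuousAt (by rw [hfix]; exact e.open_source.mem_nhds hxe), hinv, hinvertible]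
      with x h1 h2 h3 h4 h5
    exact ⟨h1, h2, h3, h4, h5⟩
  -- A straight line of fixed vectors of `A`; its preimage under `h` is the required curve.
  let l : ℝ → E := fun τ => h x₀ + τ • v
  have hl0 : l 0 = e x₀ := by simp [l, he]
  have hlsm : ContDiff ℝ ∞ l := contDiff_const.add (contDiff_id.smul contDiff_const)
  have hAl : ∀ τ, A (l τ) = l τ := fun τ => by simp [l, hAh, hv]
  have hex₀ : e.symm (e x₀) = x₀ := e.left_inv hxe
  have htend : Filter.Tendsto (fun τ => e.symm (l τ)) (𝓝 0) (𝓝 x₀) := by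
    have h1 : ContinuousAt e.symm (l 0) := by
      rw [hl0]; exact e.continuousAt_symm (e.map_source hxe)
    have := h1.comp hlsm.continuous.continuousAt
    unfold ContinuousAt at this
    simpa [Function.comp_def, hl0, hex₀] using this
  have hltgt : ∀ᶠ τ in 𝓝 (0 : ℝ), l τ ∈ e.target :=
    hlsm.continuous.continuousAt (by rw [hl0]; exact e.open_target.mem_nhds (e.map_source hxe))
  obtain ⟨ε, hε, hball⟩ := Metric.eventually_nhds_iff_ball.1 (hltgt.and (htend hgood))
  have hmem : ∀ τ ∈ Ioo (-ε) ε, τ ∈ Metric.ball (0 : ℝ) ε := fun τ hτ => by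
    simpa [Real.dist_eq, abs_lt] using hτ
  have hsmooth : ∀ τ ∈ Ioo (-ε) ε, ContDiffAt ℝ ∞ (fun τ => e.symm (l τ)) τ := by
    intro τ hτ
    obtain ⟨ht, h1, h2, h3, h4, B, hB⟩ := hball τ (hmem τ hτ)
    refine ContDiffAt.comp τ (e.contDiffAt_symm ht (f₀' := B) ?_ (hh _ h1)) hlsm.contDiffAt
    rw [hB]
    exact ((hh _ h1).differentiableAt (by simp)).hasFDerivAt
  refine ⟨ε, hε, fun τ => e.symm (l τ), fun τ hτ => (hsmooth τ hτ).contDiffWithinAt,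
    by simp only [hl0, hex₀], ?_, ?_⟩
  · intro τ hτ
    obtain ⟨ht, h1, h2, h3, h4, -⟩ := hball τ (hmem τ hτ)
    refine ⟨h1, e.injOn h3 h2 ?_⟩
    rw [he, he, hconj _ h4, ← he, e.right_inv ht, hAl]
  · have h1 : HasFDerivAt e.symm
        (((ContinuousLinearEquiv.refl ℝ E).symm : E ≃L[ℝ] E) : E →L[ℝ] E) (l 0) := by
      rw [hl0]
      exact e.hasFDerivAt_symm (e.map_source hxe) (by rw [hex₀]; exact hhd')
    have h2 : HasDerivAt l v 0 := by
      have := ((hasDerivAt_id (0 : ℝ)).smul_const v).const_add (h x₀)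
      simpa [l] using this
    exact h1.comp_hasDerivAt 0 h2

/-- A curve in a manifold whose derivative vanishes identically is constant. -/
theorem eq_of_mfderiv_eq_zero {E H M : Type*} [NormedAddCommGroup E] [NormedSpace ℝ E]
    [TopologicalSpace H] {I : ModelWithCorners ℝ E H} [I.Boundaryless] [TopologicalSpace M]
    [ChartedSpace H M] [IsManifold I 1 M] {γ : ℝ → M} (hγ : MDifferentiable 𝓘(ℝ, ℝ) I γ)
    (h0 : ∀ t, mfderiv 𝓘(ℝ, ℝ) I γ t = 0) (a b : ℝ) : γ a = γ b := by
  have hloc : IsLocallyConstant γ := by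
    rw [IsLocallyConstant.iff_eventually_eq]
    intro t
    have hsrc : ∀ᶠ u in 𝓝 t, γ u ∈ (chartAt H (γ t)).source :=
      (hγ t).continuousAt ((chartAt H (γ t)).open_source.mem_nhds (mem_chart_source H _))
    obtain ⟨ε, hε, hball⟩ := Metric.eventually_nhds_iff_ball.1 hsrc
    filter_upwards [Metric.ball_mem_nhds t hε] with u hu
    have hd : ∀ w ∈ Metric.ball t ε, HasFDerivAt (extChartAt I (γ t) ∘ γ) (0 : ℝ →L[ℝ] E) w := by
      intro w hw
      have h1 := (hγ w).hasMFDerivAt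
      rw [h0 w] at h1
      exact ((hasMFDerivAt_extChartAt (I := I) (hball w hw)).comp w h1).hasFDerivAt.congr_fderiv
        (ContinuousLinearMap.ext fun u =>
          (mfderiv I I (chartAt H (γ t)) (γ w)).map_zero)
    have hconst : (extChartAt I (γ t) ∘ γ) u = (extChartAt I (γ t) ∘ γ) t := by
      refine (convex_ball t ε).is_const_of_fderivWithin_eq_zero (𝕜 := ℝ)
        (fun w hw => (hd w hw).differentiableAt.differentiableWithinAt) (fun w hw => ?_) hu
        (Metric.mem_ball_self hε)
      rw [fderivWithin_of_isOpen Metric.isOpen_ball hw, (hd w hw).fderiv]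
    refine (extChartAt I (γ t)).injOn ?_ ?_ hconst
    · rw [extChartAt_source]; exact hball u hu
    · rw [extChartAt_source]; exact mem_chart_source H _
  exact hloc.apply_eq_of_isPreconnected isPreconnected_univ (mem_univ _) (mem_univ _)

/-- Without boundary the range of `I` is everything, so the derivative within it is an ordinary one.
The derivative is typed between the model spaces, which are the tangent spaces by definition. -/
theorem hasMFDerivAt_iff_of_boundaryless {E H M E' H' M' : Type*} [NormedAddCommGroup E]
    [NormedSpace ℝ E] [TopologicalSpace H] {I : ModelWithCorners ℝ E H}
    [I.Boundaryless] [TopologicalSpace M] [ChartedSpace H M] [NormedAddCommGroup E']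
    [NormedSpace ℝ E'] [TopologicalSpace H'] {I' : ModelWithCorners ℝ E' H'}
    [TopologicalSpace M'] [ChartedSpace H' M'] {f : M → M'} {x : M} {f' : E →L[ℝ] E'} :
    HasMFDerivAt I I' f x f' ↔
      ContinuousAt f x ∧ HasFDerivAt (writtenInExtChartAt I I' x f) f' (extChartAt I x x) := by
  refine and_congr_right fun _ => ?_
  change HasFDerivWithinAt (𝕜 := ℝ) (E := E) (F := E') (writtenInExtChartAt I I' x f) f' (range I)
    (extChartAt I x x) ↔ _
  rw [I.range_eq_univ, hasFDerivWithinAt_univ]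

/-- Through a fixed point of a smooth involution of a manifold there is a smooth curve of fixed
points with any given velocity that is fixed by the derivative. -/
theorem exists_curve_of_fixedPoints_manifold {E H M : Type*} [NormedAddCommGroup E]
    [NormedSpace ℝ E] [CompleteSpace E] [TopologicalSpace H] {I : ModelWithCorners ℝ E H}
    [I.Boundaryless] [TopologicalSpace M] [ChartedSpace H M] [IsManifold I ∞ M] {σ : M → M}
    (hσ : ContMDiff I I ∞ σ) (hinv : Function.Involutive σ) {p : M} (hp : σ p = p)
    {v : TangentSpace I p}
    (hv : (mfderiv I I σ p v : E) = v) :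
    ∃ ε > (0 : ℝ), ∃ c : ℝ → M, ContMDiffOn 𝓘(ℝ, ℝ) I ∞ c (Ioo (-ε) ε) ∧ c 0 = p ∧
      (∀ τ ∈ Ioo (-ε) ε, σ (c τ) = c τ) ∧
      HasMFDerivAt 𝓘(ℝ, ℝ) I c 0 ((1 : ℝ →L[ℝ] ℝ).smulRight (v : E)) := by
  set φ := extChartAt I p with hφ
  have hpsrc : p ∈ φ.source := mem_extChartAt_source p
  -- The chart points that `σ` does not move out of the chart domain.
  let U : Set E := φ.target ∩ φ.symm ⁻¹' (σ ⁻¹' φ.source)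
  have hcs : ContinuousOn φ.symm φ.target := continuousOn_extChartAt_symm p
  have hU : IsOpen U := hcs.isOpen_inter_preimage (isOpen_extChartAt_target p)
    ((isOpen_extChartAt_source p).preimage hσ.continuous)
  have hx₀ : φ p ∈ U := ⟨φ.map_source hpsrc, by
    simp only [mem_preimage, φ.left_inv hpsrc, hp]; exact hpsrc⟩
  let s : E → E := fun x => φ (σ (φ.symm x))
  have hsU : ContDiffOn ℝ ∞ s U := by
    rw [← contMDiffOn_iff_contDiffOn]
    have h1 : ContMDiffOn 𝓘(ℝ, E) I ∞ φ.symm U :=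
      (contMDiffOn_extChartAt_symm p).mono inter_subset_left
    have h2 : ContMDiffOn I 𝓘(ℝ, E) ∞ φ φ.source := by
      rw [hφ, extChartAt_source]; exact contMDiffOn_extChartAt
    exact h2.comp (hσ.comp_contMDiffOn h1) fun x hx => hx.2
  have hfix : s (φ p) = φ p := by simp only [s, φ.left_inv hpsrc, hp]
  have hss : ∀ᶠ x in 𝓝 (φ p), s (s x) = x := by
    filter_upwards [hU.mem_nhds hx₀] with x hx
    simp only [s]
    rw [φ.left_inv hx.2, hinv, φ.right_inv hx.1]
  have hfd : fderiv ℝ s (φ p) = (mfderiv I I σ p : E →L[ℝ] E) := by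
    have h := (hasMFDerivAt_iff_of_boundaryless.1
      ((hσ p).mdifferentiableAt (by simp)).hasMFDerivAt).2
    -- As `σ p = p`, the chart at the image point is again the chart at `p`.
    have hw : writtenInExtChartAt I I p σ = s := by
      ext x
      simp only [s, writtenInExtChartAt, Function.comp, hp, hφ]
    rw [hw] at h
    exact h.fderiv
  obtain ⟨ε, hε, y, hy, hy0, hyU, hyd⟩ := exists_curve_of_fixedPoints hU hx₀ hsU hfix hss
    (v := (v : E)) (by rw [hfd]; exact hv)
  have hymaps : MapsTo y (Ioo (-ε) ε) φ.target := fun τ hτ => (hyU τ hτ).1.1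
  have h0 : (0 : ℝ) ∈ Ioo (-ε) ε := ⟨by linarith, hε⟩
  have hc : ContMDiffOn 𝓘(ℝ, ℝ) I ∞ (fun τ => φ.symm (y τ)) (Ioo (-ε) ε) :=
    (contMDiffOn_extChartAt_symm p).comp hy.contMDiffOn hymaps
  have hc0 : φ.symm (y 0) = p := by rw [hy0, φ.left_inv hpsrc]
  have hcd : HasMFDerivAt 𝓘(ℝ, ℝ) I (fun τ => φ.symm (y τ)) 0
      ((1 : ℝ →L[ℝ] ℝ).smulRight (v : E)) := by
    refine hasMFDerivAt_iff_of_boundaryless.2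
      ⟨(hc.contMDiffAt (isOpen_Ioo.mem_nhds h0)).continuousAt, ?_⟩
    have hyd' : HasFDerivAt y ((1 : ℝ →L[ℝ] ℝ).smulRight (v : E)) 0 := hyd
    refine HasFDerivAt.congr_of_eventuallyEq hyd' ?_
    filter_upwards [isOpen_Ioo.mem_nhds (show (extChartAt 𝓘(ℝ, ℝ) (0 : ℝ)) 0 ∈ Ioo (-ε) ε from h0)]
      with τ hτ
    simp only [writtenInExtChartAt, Function.comp, hc0]
    exact φ.right_inv (hymaps hτ)
  refine ⟨ε, hε, fun τ => φ.symm (y τ), hc, hc0, ?_, hcd⟩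
  intro τ hτ
  obtain ⟨⟨h1, h2⟩, h3⟩ := hyU τ hτ
  apply φ.injOn h2 (φ.map_target h1)
  rw [φ.right_inv h1]
  exact h3

/-! ### Differential calculus and the metric on the cone -/

section ConeGeometry

variable {m : ℕ} {S : Type*} [TopologicalSpace S] [ChartedSpace (SModel m) S]

theorem contMDiff_radius :
    ContMDiff (coneI m) 𝓘(ℝ, ℝ) ∞ (fun p : Cone S => (p.2 : ℝ)) :=
  contMDiff_subtype_val.comp contMDiff_snd

/-- The charts of the open half line are restrictions of the identity. -/
theorem hasMFDerivAt_val (r : PosReal) :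
    HasMFDerivAt 𝓘(ℝ, ℝ) 𝓘(ℝ, ℝ) (Subtype.val : PosReal → ℝ) r (ContinuousLinearMap.id ℝ ℝ) := by
  refine hasMFDerivAt_iff_of_boundaryless.2 ⟨continuous_subtype_val.continuousAt, ?_⟩
  refine (hasFDerivAt_id _).congr_of_eventuallyEq ?_
  filter_upwards [extChartAt_target_mem_nhds (I := 𝓘(ℝ, ℝ)) r] with x hx
  have h := (extChartAt 𝓘(ℝ, ℝ) r).right_inv hx
  exact h

theorem hasMFDerivAt_radius (p : Cone S) :
    HasMFDerivAt (coneI m) 𝓘(ℝ, ℝ) (fun p : Cone S => (p.2 : ℝ)) p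
      (ContinuousLinearMap.snd ℝ (SModel m) ℝ) :=
  (hasMFDerivAt_val p.2).comp p (hasMFDerivAt_snd p)

theorem mfderiv_radius (p : Cone S) (v : TangentSpace (coneI m) p) :
    mfderiv (coneI m) 𝓘(ℝ, ℝ) (fun p : Cone S => (p.2 : ℝ)) p v = tangentR v := by
  rw [(hasMFDerivAt_radius p).mfderiv]; rfl

theorem mfderiv_base (p : Cone S) (v : TangentSpace (coneI m) p) :
    mfderiv (coneI m) 𝓘(ℝ, SModel m) (Prod.fst : Cone S → S) p v = tangentS v := by
  rw [(hasMFDerivAt_fst p).mfderiv]; rfl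

theorem tangent_ext {p : Cone S} {v w : TangentSpace (coneI m) p}
    (h1 : tangentS v = tangentS w) (h2 : tangentR v = tangentR w) : v = w :=
  Prod.ext h1 h2

section Deriv

variable {E H M : Type*} [NormedAddCommGroup E] [NormedSpace ℝ E] [TopologicalSpace H]
  {I : ModelWithCorners ℝ E H} [TopologicalSpace M] [ChartedSpace H M]

theorem tangentR_mfderiv {Φ : M → Cone S} {x : M} (hΦ : MDifferentiableAt I (coneI m) Φ x)
    (v : TangentSpace I x) :
    tangentR (mfderiv I (coneI m) Φ x v)
      = (mfderiv I 𝓘(ℝ, ℝ) (fun y => ((Φ y).2 : ℝ)) x v : ℝ) := by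
  rw [← mfderiv_radius]
  have h := (hasMFDerivAt_radius (m := m) (Φ x)).comp x hΦ.hasMFDerivAt
  rw [show (fun y => ((Φ y).2 : ℝ)) = (fun p : Cone S => (p.2 : ℝ)) ∘ Φ from rfl, h.mfderiv,
    (hasMFDerivAt_radius (Φ x)).mfderiv]
  rfl

theorem tangentS_mfderiv {Φ : M → Cone S} {x : M} (hΦ : MDifferentiableAt I (coneI m) Φ x)
    (v : TangentSpace I x) :
    tangentS (mfderiv I (coneI m) Φ x v)
      = mfderiv I 𝓘(ℝ, SModel m) (fun y => (Φ y).1) x v := by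
  rw [← mfderiv_base]
  have h := (hasMFDerivAt_fst (I := 𝓘(ℝ, SModel m)) (I' := 𝓘(ℝ, ℝ)) (Φ x)).comp x
    hΦ.hasMFDerivAt
  rw [show (fun y => (Φ y).1) = (Prod.fst : Cone S → S) ∘ Φ from rfl, h.mfderiv,
    (hasMFDerivAt_fst (Φ x)).mfderiv]
  rfl

theorem contMDiffAt_cone_iff {Φ : M → Cone S} {x : M} :
    ContMDiffAt I (coneI m) ∞ Φ x ↔ ContMDiffAt I 𝓘(ℝ, SModel m) ∞ (fun y => (Φ y).1) x ∧
      ContMDiffAt I 𝓘(ℝ, ℝ) ∞ (fun y => ((Φ y).2 : ℝ)) x := by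
  rw [contMDiffAt_prod_iff]
  exact and_congr_right fun _ =>
    (ContMDiffAt.subtypeVal_comp_iff PosReal (fun y => (Φ y).2) x).symm

end Deriv

section Metric

variable [IsManifold 𝓘(ℝ, SModel m) ∞ S]
  (g : Bundle.ContMDiffRiemannianMetric 𝓘(ℝ, SModel m) ∞ (SModel m)
    (fun x : S => TangentSpace 𝓘(ℝ, SModel m) x))

/-- The cone metric as a bilinear form. -/
noncomputable def coneMetricForm (p : Cone S) :
    TangentSpace (coneI m) p →ₗ[ℝ] TangentSpace (coneI m) p →ₗ[ℝ] ℝ :=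
  LinearMap.mk₂ ℝ (coneMetric g p)
    (fun v v' w => by
      have h1 : tangentS (v + v') = tangentS v + tangentS v' := rfl
      have h2 : tangentR (v + v') = tangentR v + tangentR v' := rfl
      simp only [coneMetric, h1, h2, map_add, add_apply]; ring)
    (fun a v w => by
      have h1 : tangentS (a • v) = a • tangentS v := rfl
      have h2 : tangentR (a • v) = a * tangentR v := rfl
      simp only [coneMetric, h1, h2, map_smul, smul_apply, smul_eq_mul]; ring)
    (fun v w w' => by
      have h1 : tangentS (w + w') = tangentS w + tangentS w' := rfl
      have h2 : tangentR (w + w') = tangentR w + tangentR w' := rfl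
      simp only [coneMetric, h1, h2, map_add]; ring)
    (fun a v w => by
      have h1 : tangentS (a • w) = a • tangentS w := rfl
      have h2 : tangentR (a • w) = a * tangentR w := rfl
      simp only [coneMetric, h1, h2, map_smul, smul_eq_mul]; ring)

theorem coneMetricForm_apply (p : Cone S) (v w : TangentSpace (coneI m) p) :
    coneMetricForm g p v w = coneMetric g p v w := rfl

theorem coneMetric_symm (p : Cone S) (v w : TangentSpace (coneI m) p) :
    coneMetric g p v w = coneMetric g p w v := by
  simp only [coneMetric, g.symm p.1 (tangentS v), mul_comm (tangentR v)]

theorem eq_zero_of_coneMetric_self {p : Cone S} {v : TangentSpace (coneI m) p}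
    (h : coneMetric g p v v = 0) : v = 0 := by
  have hr : 0 < (p.2 : ℝ) := p.2.2
  have h1 : 0 ≤ g.inner p.1 (tangentS v) (tangentS v) := by
    by_cases h : tangentS v = 0
    · rw [h]; simp
    · exact (g.pos p.1 _ h).le
  have h2 := mul_self_nonneg (tangentR v)
  have h3 : 0 ≤ (p.2 : ℝ) ^ 2 * g.inner p.1 (tangentS v) (tangentS v) := by positivity
  unfold coneMetric at h
  refine tangent_ext ?_ ?_
  · by_contra hv
    have := g.pos p.1 _ (show tangentS v ≠ 0 from hv)
    have : 0 < (p.2 : ℝ) ^ 2 * g.inner p.1 (tangentS v) (tangentS v) := by positivity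
    linarith
  · exact mul_self_eq_zero.1 (by linarith : tangentR v * tangentR v = 0)

theorem coneMetric_position_left (p : Cone S) (v : TangentSpace (coneI m) p) :
    coneMetric g p (position m p) v = (p.2 : ℝ) * tangentR v := by
  have h1 : tangentS (position m p) = 0 := rfl
  have h2 : tangentR (position m p) = (p.2 : ℝ) := rfl
  rw [coneMetric, h1, h2]
  simp

variable {E : Type*} [NormedAddCommGroup E] [NormedSpace ℝ E]

/-- The tangent map of `φ` is smooth, so the images of constant vector fields are smooth sections
along `φ`; inserting them into the smooth bundle map `g` gives a smooth function. -/
theorem contDiffOn_inner_mfderiv {V : Set E} (hV : IsOpen V) {φ : E → S}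
    (hφ : ContMDiffOn 𝓘(ℝ, E) 𝓘(ℝ, SModel m) ∞ φ V) (v w : E) :
    ContDiffOn ℝ ∞ (fun x => g.inner (φ x) (mfderiv 𝓘(ℝ, E) 𝓘(ℝ, SModel m) φ x v)
      (mfderiv 𝓘(ℝ, E) 𝓘(ℝ, SModel m) φ x w)) V := by
  have hsec : ∀ u : E, ContMDiffOn 𝓘(ℝ, E) (𝓘(ℝ, SModel m).prod 𝓘(ℝ, SModel m)) ∞
      (fun x => TotalSpace.mk' (SModel m) (E := fun x : S => TangentSpace 𝓘(ℝ, SModel m) x) (φ x)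
        (mfderiv 𝓘(ℝ, E) 𝓘(ℝ, SModel m) φ x u)) V := by
    intro u
    have h1 := hφ.contMDiffOn_tangentMapWithin (m := ∞) (by simp) hV.uniqueMDiffOn
    have h2 : ContMDiffOn 𝓘(ℝ, E) (𝓘(ℝ, E).prod 𝓘(ℝ, E)) ∞
        (fun x => (⟨x, u⟩ : TangentBundle 𝓘(ℝ, E) E)) V :=
      contMDiffOn_vectorSpace_iff_contDiffOn.2 contDiffOn_const
    refine (h1.comp h2 fun x hx => hx).congr fun x hx => ?_
    simp only [Function.comp, tangentMapWithin, mfderivWithin_of_isOpen hV hx]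
  rw [← contMDiffOn_iff_contDiffOn]
  have h3 := ContMDiffOn.clm_bundle_apply₂ (F₁ := SModel m) (F₂ := SModel m) (F₃ := ℝ)
    (E₁ := fun x : S => TangentSpace 𝓘(ℝ, SModel m) x)
    (E₂ := fun x : S => TangentSpace 𝓘(ℝ, SModel m) x) (E₃ := Bundle.Trivial S ℝ)
    (g.contMDiff.comp_contMDiffOn hφ) (hsec v) (hsec w)
  intro x hx
  have h4 := h3 x hx
  simp only [contMDiffWithinAt_totalSpace] at h4
  exact h4.2

/-- The coefficients of the cone metric in a smooth parametrization are smooth. -/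
theorem contDiffOn_coneMetric_mfderiv {V : Set E} (hV : IsOpen V) {Φ : E → Cone S}
    (hΦ : ContMDiffOn 𝓘(ℝ, E) (coneI m) ∞ Φ V) (v w : E) :
    ContDiffOn ℝ ∞ (fun x => coneMetric g (Φ x) (mfderiv 𝓘(ℝ, E) (coneI m) Φ x v)
      (mfderiv 𝓘(ℝ, E) (coneI m) Φ x w)) V := by
  have h1 : ContMDiffOn 𝓘(ℝ, E) 𝓘(ℝ, SModel m) ∞ (fun x => (Φ x).1) V :=
    contMDiff_fst.comp_contMDiffOn hΦ
  have h2 : ContDiffOn ℝ ∞ (fun x => ((Φ x).2 : ℝ)) V :=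
    contMDiffOn_iff_contDiffOn.1 (contMDiff_radius.comp_contMDiffOn hΦ)
  have h3 : ∀ u : E, ContDiffOn ℝ ∞ (fun x => fderiv ℝ (fun y => ((Φ y).2 : ℝ)) x u) V :=
    fun u => (h2.fderiv_of_isOpen hV (by simp)).clm_apply contDiffOn_const
  refine (((h2.pow 2).mul (contDiffOn_inner_mfderiv g hV h1 v w)).add
    ((h3 v).mul (h3 w))).congr fun x hx => ?_
  have hx' : MDifferentiableAt 𝓘(ℝ, E) (coneI m) Φ x :=
    (hΦ.contMDiffAt (hV.mem_nhds hx)).mdifferentiableAt (by simp)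
  have e1 := fun u : E => tangentS_mfderiv hx' u
  have e2 := fun u : E => tangentR_mfderiv hx' u
  simp only [mfderiv_eq_fderiv] at e2
  unfold coneMetric
  erw [e1 v, e1 w, e2 v, e2 w]
  rfl

end Metric

end ConeGeometry

/-! ### The complex torus action: generators, dilations, moment map -/

/-- The inclusion `ℝᵐ → ℂᵐ`. -/
def toC {m : ℕ} (v : Fin m → ℝ) : Fin m → ℂ := fun k => (v k : ℂ)

theorem toC_add {m : ℕ} (v w : Fin m → ℝ) : toC (v + w) = toC v + toC w := by
  ext k; simp [toC]

theorem toC_smul {m : ℕ} (a : ℝ) (v : Fin m → ℝ) : toC (a • v) = a • toC v := by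
  ext k; simp [toC]

theorem expC_zero {m : ℕ} : expC (0 : Fin m → ℂ) = 1 := by
  ext k; simp [expC]

theorem expC_add {m : ℕ} (z w : Fin m → ℂ) : expC (z + w) = expC z * expC w := by
  ext k; simp [expC, Complex.exp_add]

theorem expC_I_smul {m : ℕ} (y : Fin m → ℝ) :
    expC (Complex.I • toC y) = fun k => Circle.toUnits (expT y k) := by
  ext k; simp [expC, expT, toC, mul_comm]

section

variable {m : ℕ} {S : Type*} [TopologicalSpace S] [ChartedSpace (SModel m) S]

/-- The definition of a complex structure here does not list J² = -1; it follows because dφ is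
injective and turns `J` into multiplication by i. -/
theorem isComplexStructure_sq {J : ∀ p : Cone S, TangentSpace (coneI m) p →L[ℝ] TangentSpace (coneI m) p}
    (hJ : IsComplexStructure J) (p : Cone S) (v : TangentSpace (coneI m) p) :
    J p (J p v) = -v := by
  obtain ⟨U, φ, hp, h⟩ := hJ p
  apply (h.bijective p hp).1
  rw [h.map_J p hp, h.map_J p hp, smul_smul, Complex.I_mul_I, neg_one_smul]
  exact ((mfderiv (coneI m) 𝓘(ℝ, Fin m → ℂ) φ p).map_neg v).symm

theorem contMDiff_dilate (ρ : PosReal) :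
    ContMDiff (coneI m) (coneI m) ∞ (dilate ρ : Cone S → Cone S) := by
  intro p
  refine contMDiffAt_cone_iff.2 ⟨contMDiff_fst p, ?_⟩
  exact contMDiffAt_const.mul (contMDiff_radius p)

theorem tangentS_mfderiv_dilate (ρ : PosReal) (p : Cone S) (v : TangentSpace (coneI m) p) :
    tangentS (mfderiv (coneI m) (coneI m) (dilate ρ) p v) = tangentS v := by
  rw [tangentS_mfderiv ((contMDiff_dilate ρ p).mdifferentiableAt (by simp))]
  exact mfderiv_base p v

theorem tangentR_mfderiv_dilate (ρ : PosReal) (p : Cone S) (v : TangentSpace (coneI m) p) :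
    tangentR (mfderiv (coneI m) (coneI m) (dilate ρ) p v) = ρ * tangentR v := by
  rw [tangentR_mfderiv ((contMDiff_dilate ρ p).mdifferentiableAt (by simp))]
  have h := (hasMFDerivAt_radius (m := m) p).const_smul (ρ : ℝ)
  have h2 := h.mfderiv
  have : (fun y : Cone S => ((dilate ρ y).2 : ℝ)) = (ρ : ℝ) • fun p : Cone S => (p.2 : ℝ) := rfl
  rw [this, h2]
  rfl

variable [IsManifold 𝓘(ℝ, SModel m) ∞ S]

/-- Both r and dr are scaled by `ρ` while the `S`-component is untouched, so both summands of r² g +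
dr² scale by `ρ`². -/
theorem coneMetric_dilate
    (g : Bundle.ContMDiffRiemannianMetric 𝓘(ℝ, SModel m) ∞ (SModel m)
      (fun x : S => TangentSpace 𝓘(ℝ, SModel m) x)) (ρ : PosReal) (p : Cone S)
    (v w : TangentSpace (coneI m) p) :
    coneMetric g (dilate ρ p) (mfderiv (coneI m) (coneI m) (dilate ρ) p v)
      (mfderiv (coneI m) (coneI m) (dilate ρ) p w) = (ρ : ℝ) ^ 2 * coneMetric g p v w := by
  unfold coneMetric
  rw [tangentR_mfderiv_dilate, tangentR_mfderiv_dilate]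
  erw [tangentS_mfderiv_dilate, tangentS_mfderiv_dilate]
  change (((ρ : ℝ) * (p.2 : ℝ)) ^ 2) * g.inner p.1 (tangentS v) (tangentS w) + _ = _
  ring

variable {X : ToricSasakiManifold m S}

theorem J_sq (X : ToricSasakiManifold m S) (p : Cone S) (v : TangentSpace (coneI m) p) :
    X.J p (X.J p v) = -v := isComplexStructure_sq X.isComplexStructure p v

theorem J_injective (X : ToricSasakiManifold m S) (p : Cone S) :
    Function.Injective (X.J p) := fun v w h => by
  have := congrArg (X.J p) h
  rw [J_sq, J_sq] at this
  exact neg_injective this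

/-- All tangent spaces are definitionally the model space, so one vector can be read at two equal
base points, such as `Y.orbit p 0` and `p`. -/
theorem J_congr (X : ToricSasakiManifold m S) {p q : Cone S} (h : q = p) (v : SModel m × ℝ) :
    (X.J q v : SModel m × ℝ) = X.J p v := by
  subst h; rfl

namespace ToricCone

/-- The action of `exp z` on the cone. -/
noncomputable def translate (Y : ToricCone X) (z : Fin m → ℂ) : Cone S → Cone S := fun p => Y.act (expC z) p

/-- The map from `ℂᵐ` to the orbit of `p`. -/
noncomputable def orbit (Y : ToricCone X) (p : Cone S) : (Fin m → ℂ) → Cone S := fun z => Y.act (expC z) p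

variable (Y : ToricCone X)

theorem translate_zero (p : Cone S) : Y.translate 0 p = p := by
  simp [translate, expC_zero]

theorem translate_add (z w : Fin m → ℂ) (p : Cone S) :
    Y.translate (z + w) p = Y.translate z (Y.translate w p) := by
  simp [translate, expC_add]

theorem orbit_add (p : Cone S) (z w : Fin m → ℂ) :
    Y.orbit p (z + w) = Y.translate z (Y.orbit p w) := Y.translate_add z w p

theorem orbit_zero (p : Cone S) : Y.orbit p 0 = p := Y.translate_zero p

theorem translate_I_smul (y : Fin m → ℝ) :
    Y.translate (Complex.I • toC y) = torusAct X.T (expT y) := by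
  ext1 p
  rw [translate, expC_I_smul, Y.act_torus]

theorem contMDiff_translate (z : Fin m → ℂ) : ContMDiff (coneI m) (coneI m) ∞ (Y.translate z) :=
  Y.smooth_act.comp (contMDiff_const.prodMk contMDiff_id)

theorem contMDiff_orbit (p : Cone S) : ContMDiff 𝓘(ℝ, Fin m → ℂ) (coneI m) ∞ (Y.orbit p) :=
  Y.smooth_act.comp (contMDiff_id.prodMk contMDiff_const)

theorem mdifferentiableAt_translate (z : Fin m → ℂ) (p : Cone S) :
    MDifferentiableAt (coneI m) (coneI m) (Y.translate z) p :=
  (Y.contMDiff_translate z p).mdifferentiableAt (by simp)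

theorem mdifferentiableAt_orbit (p : Cone S) (z : Fin m → ℂ) :
    MDifferentiableAt 𝓘(ℝ, Fin m → ℂ) (coneI m) (Y.orbit p) z :=
  (Y.contMDiff_orbit p z).mdifferentiableAt (by simp)

/-- Holomorphy of the action is a statement about the joint derivative in (z, p); the two partial
derivatives have to be extracted from it. -/
theorem mfderiv_orbit_eq (z : Fin m → ℂ) (p : Cone S) (u : Fin m → ℂ) :
    (mfderiv 𝓘(ℝ, Fin m → ℂ) (coneI m) (Y.orbit p) z u : SModel m × ℝ)
      = mfderiv ((𝓘(ℝ, Fin m → ℂ)).prod (coneI m)) (coneI m)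
        (fun x : (Fin m → ℂ) × Cone S => Y.act (expC x.1) x.2) (z, p) (u, 0) := by
  have h := ((Y.smooth_act (z, p)).mdifferentiableAt (by simp)).hasMFDerivAt.comp z
    ((hasMFDerivAt_id z).prodMk (hasMFDerivAt_const p z))
  rw [show Y.orbit p = (fun x : (Fin m → ℂ) × Cone S => Y.act (expC x.1) x.2) ∘
    fun z => (id z, p) from rfl, h.mfderiv]
  rfl

theorem mfderiv_translate_eq (z : Fin m → ℂ) (p : Cone S) (v : TangentSpace (coneI m) p) :
    (mfderiv (coneI m) (coneI m) (Y.translate z) p v : SModel m × ℝ)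
      = mfderiv ((𝓘(ℝ, Fin m → ℂ)).prod (coneI m)) (coneI m)
        (fun x : (Fin m → ℂ) × Cone S => Y.act (expC x.1) x.2) (z, p) (0, v) := by
  have h := ((Y.smooth_act (z, p)).mdifferentiableAt (by simp)).hasMFDerivAt.comp p
    ((hasMFDerivAt_const z p).prodMk (hasMFDerivAt_id p))
  rw [show Y.translate z = (fun x : (Fin m → ℂ) × Cone S => Y.act (expC x.1) x.2) ∘
    Prod.mk z from rfl, h.mfderiv]
  rfl

theorem mfderiv_translate_J (z : Fin m → ℂ) (p : Cone S) (v : TangentSpace (coneI m) p) :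
    mfderiv (coneI m) (coneI m) (Y.translate z) p (X.J p v)
      = X.J (Y.translate z p) (mfderiv (coneI m) (coneI m) (Y.translate z) p v) := by
  have h := Y.holomorphic_act z p 0 v
  rw [smul_zero] at h
  exact (Y.mfderiv_translate_eq z p (X.J p v)).trans
    (h.trans (congrArg (X.J _) (Y.mfderiv_translate_eq z p v).symm))

theorem mfderiv_orbit_I_smul (z : Fin m → ℂ) (p : Cone S) (u : Fin m → ℂ) :
    mfderiv 𝓘(ℝ, Fin m → ℂ) (coneI m) (Y.orbit p) z (Complex.I • u : Fin m → ℂ)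
      = X.J (Y.orbit p z) (mfderiv 𝓘(ℝ, Fin m → ℂ) (coneI m) (Y.orbit p) z u) := by
  have h := Y.holomorphic_act z p u 0
  have e : X.J p 0 = 0 := (X.J p).map_zero
  rw [e] at h
  exact (Y.mfderiv_orbit_eq z p (Complex.I • u)).trans
    (h.trans (congrArg (X.J _) (Y.mfderiv_orbit_eq z p u).symm))

/-- The generating vector of the action of `ℂᵐ` at `p`. -/
noncomputable def gen (p : Cone S) : (Fin m → ℂ) →L[ℝ] TangentSpace (coneI m) p :=
  (mfderiv 𝓘(ℝ, Fin m → ℂ) (coneI m) (Y.orbit p) 0 : (Fin m → ℂ) →L[ℝ] SModel m × ℝ)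

/-- The point is a variable with a proof that it is zero, so that the chain rule applies at
expressions such as `z - z` or `0 • u`. -/
theorem hasMFDerivAt_orbit_of_eq_zero (p : Cone S) {z : Fin m → ℂ} (hz : z = 0) :
    HasMFDerivAt 𝓘(ℝ, Fin m → ℂ) (coneI m) (Y.orbit p) z
      (Y.gen p : (Fin m → ℂ) →L[ℝ] SModel m × ℝ) := by
  subst hz
  exact (Y.mdifferentiableAt_orbit p 0).hasMFDerivAt

theorem gen_I_smul (p : Cone S) (u : Fin m → ℂ) : Y.gen p (Complex.I • u) = X.J p (Y.gen p u) :=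
  (Y.mfderiv_orbit_I_smul 0 p u).trans (J_congr X (Y.orbit_zero p) _)

/-- By the group law the orbit map of `p` near `z` is the orbit map of the moved point near 0,
precomposed with a shift. -/
theorem mfderiv_orbit (p : Cone S) (z u : Fin m → ℂ) :
    mfderiv 𝓘(ℝ, Fin m → ℂ) (coneI m) (Y.orbit p) z u = Y.gen (Y.orbit p z) u := by
  have h1 : Y.orbit p = Y.orbit (Y.orbit p z) ∘ fun w => w - z := by
    ext1 w
    change _ = Y.translate (w - z) (Y.translate z p)
    rw [← Y.translate_add, sub_add_cancel]; rfl
  have h2 : HasMFDerivAt 𝓘(ℝ, Fin m → ℂ) 𝓘(ℝ, Fin m → ℂ) (fun w => w - z) z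
      (ContinuousLinearMap.id ℝ (Fin m → ℂ)) := ((hasFDerivAt_id z).sub_const z).hasMFDerivAt
  have h3 := HasMFDerivAt.comp (f := fun w => w - z) z
    (Y.hasMFDerivAt_orbit_of_eq_zero (Y.orbit p z) (sub_self z)) h2
  rw [← h1] at h3
  rw [h3.mfderiv]
  rfl

/-- The group is commutative, so its generating vector fields are invariant under translations. -/
theorem mfderiv_translate_gen (p : Cone S) (z u : Fin m → ℂ) :
    mfderiv (coneI m) (coneI m) (Y.translate z) p (Y.gen p u) = Y.gen (Y.translate z p) u := by
  have h1 : Y.orbit p ∘ (fun w => z + w) = Y.translate z ∘ Y.orbit p := by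
    ext1 w
    exact Y.orbit_add p z w
  have h2 : HasMFDerivAt 𝓘(ℝ, Fin m → ℂ) 𝓘(ℝ, Fin m → ℂ) (fun w => z + w) 0
      (ContinuousLinearMap.id ℝ (Fin m → ℂ)) := ((hasFDerivAt_id 0).const_add z).hasMFDerivAt
  have h3 := (Y.mdifferentiableAt_orbit p (z + 0)).hasMFDerivAt.comp 0 h2
  have h4 := (Y.mdifferentiableAt_translate z (Y.orbit p 0)).hasMFDerivAt.comp 0
    (Y.mdifferentiableAt_orbit p 0).hasMFDerivAt
  rw [h1] at h3
  have h5 := congrArg (fun B : (Fin m → ℂ) →L[ℝ] SModel m × ℝ => B u) (hasMFDerivAt_unique h4 h3)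
  have h6 : mfderiv (coneI m) (coneI m) (Y.translate z) (Y.orbit p 0) (Y.gen p u : SModel m × ℝ)
      = mfderiv 𝓘(ℝ, Fin m → ℂ) (coneI m) (Y.orbit p) (z + 0) u := h5
  rw [add_zero, Y.mfderiv_orbit, Y.orbit_zero] at h6
  exact h6

/-- The compact torus is the image of the imaginary directions of ℂᵐ. -/
theorem fundamentalField_eq (v : Fin m → ℝ) (p : Cone S) :
    fundamentalField X.T v p = Y.gen p (Complex.I • toC v) := by
  have h1 : (fun t : ℝ => torusAct X.T (expT (t • v)) p)
      = Y.orbit p ∘ fun t : ℝ => t • (Complex.I • toC v) := by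
    ext1 t
    rw [← Y.translate_I_smul, toC_smul, smul_comm]
    rfl
  have h2 : HasMFDerivAt 𝓘(ℝ, ℝ) 𝓘(ℝ, Fin m → ℂ) (fun t : ℝ => t • (Complex.I • toC v)) 0
      ((1 : ℝ →L[ℝ] ℝ).smulRight (Complex.I • toC v)) := by
    have : HasFDerivAt (fun t : ℝ => t • (Complex.I • toC v))
      ((1 : ℝ →L[ℝ] ℝ).smulRight (Complex.I • toC v)) 0 := (hasFDerivAt_id (0 : ℝ)).smul_const _
    exact this.hasMFDerivAt
  have h0 : HasMFDerivAt 𝓘(ℝ, Fin m → ℂ) (coneI m) (Y.orbit p)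
      ((fun t : ℝ => t • (Complex.I • toC v)) 0) (Y.gen p : (Fin m → ℂ) →L[ℝ] SModel m × ℝ) :=
    Y.hasMFDerivAt_orbit_of_eq_zero p (zero_smul ℝ _)
  have h3 := (h0.comp 0 h2).mfderiv
  unfold fundamentalField
  rw [h1, h3]
  change (Y.gen p : (Fin m → ℂ) →L[ℝ] SModel m × ℝ) ((1 : ℝ) • (Complex.I • toC v)) = _
  rw [one_smul]

/-- Multiplying by i gives the Reeb field J(r∂ᵣ) on both sides, and `J` is injective. So the real
direction ξ generates the radial flow. -/
theorem gen_reeb (p : Cone S) : Y.gen p (toC X.reeb) = position m p := by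
  apply J_injective X p
  rw [← Y.gen_I_smul, ← Y.fundamentalField_eq, X.reeb_generates]

theorem mfderiv_orbit_smul_reeb (p : Cone S) (s : ℝ) :
    HasMFDerivAt 𝓘(ℝ, ℝ) (coneI m) (fun s : ℝ => Y.orbit p (s • toC X.reeb)) s
      ((1 : ℝ →L[ℝ] ℝ).smulRight (position m (Y.orbit p (s • toC X.reeb)) : SModel m × ℝ)) := by
  have h2 : HasMFDerivAt 𝓘(ℝ, ℝ) 𝓘(ℝ, Fin m → ℂ) (fun t : ℝ => t • toC X.reeb) s
      ((1 : ℝ →L[ℝ] ℝ).smulRight (toC X.reeb)) := by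
    have : HasFDerivAt (fun t : ℝ => t • toC X.reeb)
      ((1 : ℝ →L[ℝ] ℝ).smulRight (toC X.reeb)) s := (hasFDerivAt_id s).smul_const _
    exact this.hasMFDerivAt
  have h3 := (Y.mdifferentiableAt_orbit p (s • toC X.reeb)).hasMFDerivAt.comp s h2
  have h4 : (mfderiv 𝓘(ℝ, Fin m → ℂ) (coneI m) (Y.orbit p) (s • toC X.reeb) (toC X.reeb)
      : SModel m × ℝ) = position m (Y.orbit p (s • toC X.reeb)) := by
    rw [Y.mfderiv_orbit, Y.gen_reeb]
  rw [← h4]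
  refine h3.congr_mfderiv (ContinuousLinearMap.ext fun a => ?_)
  exact ((mfderiv 𝓘(ℝ, Fin m → ℂ) (coneI m) (Y.orbit p) (s • toC X.reeb)).map_smul a
    (toC X.reeb))

/-- The dilation by `e^s` is the action of `exp(s ξ)`. -/
theorem translate_smul_reeb (s : ℝ) :
    Y.translate (s • toC X.reeb) = dilate ⟨Real.exp s, Real.exp_pos s⟩ := by
  ext1 p
  -- The curve s ↦ exp(s ξ) · p is an integral curve of r∂ᵣ: its `S`-component has zero derivative
  -- and its radius solves R' = R.
  have hd := Y.mfderiv_orbit_smul_reeb p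
  have hz : Y.orbit p ((0 : ℝ) • toC X.reeb) = p := by rw [zero_smul, Y.orbit_zero]
  refine Prod.ext ?_ (Subtype.ext ?_)
  · have hS : ∀ t, HasMFDerivAt 𝓘(ℝ, ℝ) 𝓘(ℝ, SModel m)
        (fun s : ℝ => (Y.orbit p (s • toC X.reeb)).1) t (0 : ℝ →L[ℝ] SModel m) := by
      intro t
      have h := (hasMFDerivAt_fst (I := 𝓘(ℝ, SModel m)) (I' := 𝓘(ℝ, ℝ))
        (Y.orbit p (t • toC X.reeb))).comp t (hd t)
      refine h.congr_mfderiv (ContinuousLinearMap.ext fun a => ?_)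
      exact smul_zero (M := ℝ) (A := SModel m) a
    have h := eq_of_mfderiv_eq_zero (I := 𝓘(ℝ, SModel m)) (fun t => (hS t).mdifferentiableAt)
      (fun t => (hS t).mfderiv) s 0
    simp only [hz] at h
    exact h
  · have hR : ∀ t, HasDerivAt (fun s : ℝ => ((Y.orbit p (s • toC X.reeb)).2 : ℝ))
        ((Y.orbit p (t • toC X.reeb)).2 : ℝ) t := by
      intro t
      have h : HasFDerivAt (fun s : ℝ => ((Y.orbit p (s • toC X.reeb)).2 : ℝ))
          ((1 : ℝ →L[ℝ] ℝ).smulRight ((Y.orbit p (t • toC X.reeb)).2 : ℝ)) t := by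
        have h0 := ((hasMFDerivAt_radius (m := m) (Y.orbit p (t • toC X.reeb))).comp t
          (hd t)).hasFDerivAt
        exact h0.congr_fderiv (ContinuousLinearMap.ext fun a => rfl)
      simpa using h.hasDerivAt
    have hc : ∀ t, HasDerivAt
        (fun s : ℝ => Real.exp (-s) * ((Y.orbit p (s • toC X.reeb)).2 : ℝ)) 0 t := by
      intro t
      exact ((hasDerivAt_neg t).exp.mul (hR t)).congr_deriv (by ring)
    have h := is_const_of_deriv_eq_zero (fun t => (hc t).differentiableAt)
      (fun t => (hc t).deriv) s 0
    simp only [hz, neg_zero, Real.exp_zero, one_mul] at h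
    change ((Y.orbit p (s • toC X.reeb)).2 : ℝ) = Real.exp s * (p.2 : ℝ)
    rw [← h, ← mul_assoc, ← Real.exp_add, add_neg_cancel, Real.exp_zero, one_mul]

/-- The translation is an isometry of the compact torus followed by the dilation by e^s. -/
theorem coneMetric_translate (s : ℝ) (y : Fin m → ℝ) (p : Cone S)
    (v w : TangentSpace (coneI m) p) :
    coneMetric X.g (Y.translate (s • toC X.reeb + Complex.I • toC y) p)
      (mfderiv (coneI m) (coneI m) (Y.translate (s • toC X.reeb + Complex.I • toC y)) p v)
      (mfderiv (coneI m) (coneI m) (Y.translate (s • toC X.reeb + Complex.I • toC y)) p w)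
      = Real.exp s ^ 2 * coneMetric X.g p v w := by
  have h1 : Y.translate (s • toC X.reeb + Complex.I • toC y)
      = dilate ⟨Real.exp s, Real.exp_pos s⟩ ∘ torusAct X.T (expT y) := by
    rw [← Y.translate_smul_reeb, ← Y.translate_I_smul]
    ext1 q
    exact Y.translate_add _ _ q
  have h2 : MDifferentiableAt (coneI m) (coneI m) (torusAct X.T (expT y)) p := by
    rw [← Y.translate_I_smul]; exact Y.mdifferentiableAt_translate _ p
  have h3 := (((contMDiff_dilate (m := m) (S := S) ⟨Real.exp s, Real.exp_pos s⟩
    (torusAct X.T (expT y) p)).mdifferentiableAt (by simp)).hasMFDerivAt.comp p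
      h2.hasMFDerivAt).mfderiv
  rw [h1, h3]
  exact (coneMetric_dilate X.g ⟨Real.exp s, Real.exp_pos s⟩ (torusAct X.T (expT y) p) _ _).trans
    (congrArg _ (X.isometric_T (expT y) p v w))

theorem kahlerForm_translate (s : ℝ) (y : Fin m → ℝ) (p : Cone S)
    (v w : TangentSpace (coneI m) p) :
    X.kahlerForm (Y.translate (s • toC X.reeb + Complex.I • toC y) p)
      (mfderiv (coneI m) (coneI m) (Y.translate (s • toC X.reeb + Complex.I • toC y)) p v)
      (mfderiv (coneI m) (coneI m) (Y.translate (s • toC X.reeb + Complex.I • toC y)) p w)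
      = Real.exp s ^ 2 * X.kahlerForm p v w := by
  unfold SasakiManifold.kahlerForm SasakiManifold.metric
  rw [← Y.mfderiv_translate_J, Y.coneMetric_translate]

/-- By linearity the left side is ḡ(J r∂ᵣ, J r∂ᵣ)/2 = ḡ(r∂ᵣ, r∂ᵣ)/2. The level sets of this
component of the moment map are spheres, and ξ is positive on the moment image. -/
theorem pairing_moment_reeb (Y : ToricCone X) (p : Cone S) :
    pairing (X.moment p) X.reeb = 1 / 2 * (p.2 : ℝ) ^ 2 := by
  have hr : (p.2 : ℝ) ≠ 0 := ne_of_gt p.2.2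
  have h1 : ∀ k, X.moment p k * X.reeb k = 1 / 2 * coneMetricForm X.g p (X.J p (position m p))
      (Y.gen p (X.reeb k • (Complex.I • toC (Pi.single k 1)))) := by
    intro k
    rw [map_smul, map_smul, ← Y.fundamentalField_eq, smul_eq_mul, coneMetricForm_apply]
    unfold ToricSasakiManifold.moment SasakiManifold.contactForm SasakiManifold.reebField
      SasakiManifold.metric
    field_simp
  have h2 : ∑ k, X.reeb k • (Complex.I • toC (Pi.single k (1 : ℝ)))
      = Complex.I • toC X.reeb := by
    ext j
    simp [toC, Finset.sum_apply, Pi.single_apply, apply_ite, mul_comm]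
  unfold pairing
  rw [Finset.sum_congr rfl fun k _ => h1 k, ← Finset.mul_sum, ← map_sum, ← map_sum, h2,
    Y.gen_I_smul, Y.gen_reeb, coneMetricForm_apply, X.compatible, coneMetric_position_left]
  change 1 / 2 * ((p.2 : ℝ) * (p.2 : ℝ)) = _
  ring

end ToricCone

end

/-! ### Density of the open orbit and isotropy of the torus orbits -/

theorem fderiv_apply_eq_zero_of_const {E : Type*} [NormedAddCommGroup E] [NormedSpace ℝ E]
    {F : E → ℝ} {z u : E} (h : ∀ t : ℝ, F (z + t • u) = F z) : fderiv ℝ F z u = 0 := by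
  by_cases hd : DifferentiableAt ℝ F z
  · rw [← hd.lineDeriv_eq_fderiv, lineDeriv]
    simp only [h, deriv_const]
  -- The default value of `fderiv` makes a differentiability hypothesis unnecessary.
  · rw [fderiv_zero_of_not_differentiableAt hd]; rfl

section

variable {m : ℕ} {S : Type*} [TopologicalSpace S] [ChartedSpace (SModel m) S]
  [IsManifold 𝓘(ℝ, SModel m) ∞ S]

/-- A tensor on the cone whose coefficients in smooth parametrizations are continuous vanishes if
it vanishes over a dense set. -/
theorem eq_zero_of_dense {D : Set (Cone S)} (hD : Dense D) {ι F : Type*} [TopologicalSpace F]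
    [T1Space F] [Zero F] (A : ∀ p : Cone S, (ι → TangentSpace (coneI m) p) → F)
    (hA : ∀ (V : Set (SModel m × ℝ)) (Φ : SModel m × ℝ → Cone S), IsOpen V →
      ContMDiffOn 𝓘(ℝ, SModel m × ℝ) (coneI m) ∞ Φ V → ∀ v : ι → SModel m × ℝ,
      ContinuousOn (fun x => A (Φ x) fun j => mfderiv 𝓘(ℝ, SModel m × ℝ) (coneI m) Φ x (v j)) V)
    (h0 : ∀ p ∈ D, ∀ v, A p v = 0) (p : Cone S) (v : ι → TangentSpace (coneI m) p) :
    A p v = 0 := by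
  set φ := extChartAt (coneI m) p with hφ
  have hpsrc : p ∈ φ.source := mem_extChartAt_source p
  have hV : IsOpen φ.target := isOpen_extChartAt_target p
  have hpt : φ p ∈ φ.target := φ.map_source hpsrc
  have hΦ : ContMDiffOn 𝓘(ℝ, SModel m × ℝ) (coneI m) ∞ φ.symm φ.target :=
    contMDiffOn_extChartAt_symm p
  have hback : φ.symm (φ p) = p := φ.left_inv hpsrc
  have hid := mfderivWithin_extChartAt_symm_comp_mfderiv_extChartAt' (I := coneI m) hpsrc
  rw [(coneI m).range_eq_univ, mfderivWithin_univ, ← hφ] at hid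
  -- Keeping the chart coordinates of `v j` constant extends these vectors to nearby points, in
  -- particular to points of `D` close to `p`.
  let u : ι → SModel m × ℝ := fun j =>
    mfderiv (coneI m) 𝓘(ℝ, SModel m × ℝ) φ p (v j)
  have hu : ∀ j, (mfderiv 𝓘(ℝ, SModel m × ℝ) (coneI m) φ.symm (φ p) (u j) : SModel m × ℝ) = v j :=
    fun j => congrArg (fun B : SModel m × ℝ →L[ℝ] SModel m × ℝ => B (v j)) hid
  have hcont := hA φ.target φ.symm hV hΦ u
  have hcl : φ p ∈ closure (φ.target ∩ φ.symm ⁻¹' D) := by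
    rw [mem_closure_iff]
    intro N hN hpN
    have hopen : IsOpen (φ.source ∩ φ ⁻¹' N) :=
      (continuousOn_extChartAt p).isOpen_inter_preimage (isOpen_extChartAt_source p) hN
    obtain ⟨q, ⟨hq1, hq2⟩, hqD⟩ := hD.inter_open_nonempty _ hopen ⟨p, hpsrc, hpN⟩
    exact ⟨φ q, hq2, φ.map_source hq1, by rw [mem_preimage, φ.left_inv hq1]; exact hqD⟩
  have hzero : A (φ.symm (φ p)) (fun j => mfderiv 𝓘(ℝ, SModel m × ℝ) (coneI m) φ.symm (φ p) (u j))
      = 0 := by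
    have hw := (hcont.continuousWithinAt hpt).mono (inter_subset_left (t := φ.symm ⁻¹' D))
    have hmem := hw.mem_closure hcl (t := {(0 : F)}) fun x hx => by
      exact h0 _ hx.2 _
    simpa using hmem
  -- The value was computed over `φ.symm (φ p)`, which equals `p` only propositionally.
  have key : ∀ q (_ : q = p) (w : ι → SModel m × ℝ), (∀ j, w j = v j) → A q w = 0 → A p v = 0 := by
    rintro q rfl w hw h
    rwa [show w = v from funext hw] at h
  exact key _ hback _ hu hzero

-- Locally the form is h(φ) times the determinant of dφ; the coefficient h is continuous since it is
-- holomorphic, and dφ is continuous along `Φ`.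
omit [IsManifold 𝓘(ℝ, SModel m) ∞ S] in
theorem continuousOn_volumeForm {J : ∀ p : Cone S, TangentSpace (coneI m) p →L[ℝ] TangentSpace (coneI m) p}
    {Ω : ∀ p : Cone S, TangentSpace (coneI m) p [⋀^Fin m]→ₗ[ℝ] ℂ}
    (hΩ : IsHolomorphicVolumeForm J Ω) {E : Type*} [NormedAddCommGroup E] [NormedSpace ℝ E]
    {V : Set E} (hV : IsOpen V) {Φ : E → Cone S} (hΦ : ContMDiffOn 𝓘(ℝ, E) (coneI m) ∞ Φ V)
    (v : Fin m → E) :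
    ContinuousOn (fun x => Ω (Φ x) fun j => mfderiv 𝓘(ℝ, E) (coneI m) Φ x (v j)) V := by
  intro x hx
  refine ContinuousAt.continuousWithinAt ?_
  obtain ⟨U, φ, hpU, hφ, h, hh, hform⟩ := hΩ (Φ x)
  have hW : IsOpen (V ∩ Φ ⁻¹' U) := hΦ.continuousOn.isOpen_inter_preimage hV hφ.isOpen
  have hxW : x ∈ V ∩ Φ ⁻¹' U := ⟨hx, hpU⟩
  have hcomp : ContDiffOn ℝ ∞ (φ ∘ Φ) (V ∩ Φ ⁻¹' U) :=
    contMDiffOn_iff_contDiffOn.1 (hφ.smooth.comp (hΦ.mono inter_subset_left) fun y hy => hy.2)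
  have hcd : ContinuousOn (fderiv ℝ (φ ∘ Φ)) (V ∩ Φ ⁻¹' U) :=
    hcomp.continuousOn_fderiv_of_isOpen hW (by simp)
  have hmain : ContinuousOn (fun y => h (φ (Φ y)) *
      Matrix.det (Matrix.of fun j k => fderiv ℝ (φ ∘ Φ) y (v j) k)) (V ∩ Φ ⁻¹' U) := by
    refine ContinuousOn.mul (hh.continuousOn.comp hcomp.continuousOn fun y hy => ⟨_, hy.2, rfl⟩) ?_
    have hmat : ContinuousOn (fun y => (Matrix.of fun j k => fderiv ℝ (φ ∘ Φ) y (v j) k :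
        Matrix (Fin m) (Fin m) ℂ)) (V ∩ Φ ⁻¹' U) := by
      refine continuousOn_pi.2 fun j => continuousOn_pi.2 fun k => ?_
      exact (continuous_apply k).comp_continuousOn (hcd.clm_apply continuousOn_const)
    exact (continuous_id.matrix_det).comp_continuousOn hmat
  refine (hmain.continuousAt (hW.mem_nhds hxW)).congr ?_
  filter_upwards [hW.mem_nhds hxW] with y hy
  rw [(hform (Φ y) hy.2).2]
  congr 3
  ext j k
  have h1 : MDifferentiableAt (coneI m) 𝓘(ℝ, Fin m → ℂ) φ (Φ y) :=
    (hφ.smooth.contMDiffAt (hφ.isOpen.mem_nhds hy.2)).mdifferentiableAt (by simp)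
  have h2 : MDifferentiableAt 𝓘(ℝ, E) (coneI m) Φ y :=
    (hΦ.contMDiffAt (hV.mem_nhds hy.1)).mdifferentiableAt (by simp)
  have h3 := (h1.hasMFDerivAt.comp y h2.hasMFDerivAt).mfderiv
  rw [mfderiv_eq_fderiv] at h3
  rw [h3]
  rfl

/-- The Kähler form as a bilinear form. -/
noncomputable def kahlerBilin (X : ToricSasakiManifold m S) (p : Cone S) :
    TangentSpace (coneI m) p →ₗ[ℝ] TangentSpace (coneI m) p →ₗ[ℝ] ℝ :=
  (coneMetricForm X.g p).comp (X.J p : TangentSpace (coneI m) p →ₗ[ℝ] TangentSpace (coneI m) p)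

theorem kahlerBilin_J (X : ToricSasakiManifold m S) (p : Cone S)
    (v w : TangentSpace (coneI m) p) :
    kahlerBilin X p (X.J p v) (X.J p w) = kahlerBilin X p v w :=
  X.compatible p (X.J p v) w

theorem kahlerBilin_J_right (X : ToricSasakiManifold m S) (p : Cone S)
    (v w : TangentSpace (coneI m) p) :
    kahlerBilin X p v (X.J p w) = coneMetric X.g p v w := X.compatible p v w

variable {X : ToricSasakiManifold m S}

/-- For m = 0 the truncated 2m - 1 is 0 and the cone would have dimension 1, hence the hypothesis `1
≤ m`. -/
theorem finrank_cone (hm : 1 ≤ m) : Module.finrank ℝ (SModel m × ℝ) = 2 * m := by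
  simp only [Module.finrank_prod, finrank_euclideanSpace, Fintype.card_fin, Module.finrank_self]
  omega

namespace ToricCone

theorem gen_translate_base (Y : ToricCone X) (p : Cone S) (z u : Fin m → ℂ) :
    Y.gen (Y.translate z p) u = mfderiv (coneI m) (coneI m) (Y.translate z) p (Y.gen p u) :=
  (Y.mfderiv_translate_gen p z u).symm

/-- If the generator of `u` vanishes at `q`, it vanishes along the whole curve exp(t u) · q by
invariance, so the curve is constant. Freeness gives exp(t u) = 1 for all t, and differentiating at
t = 0 gives u = 0. -/
theorem gen_injective (Y : ToricCone X) (z : Fin m → ℂ) :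
    Function.Injective (Y.gen (Y.orbit Y.base z)) := by
  rw [injective_iff_map_eq_zero]
  intro u hu
  set q := Y.orbit Y.base z with hq
  have hder : ∀ t : ℝ, HasMFDerivAt 𝓘(ℝ, ℝ) (coneI m) (fun s : ℝ => Y.orbit q (s • u)) t
      (0 : ℝ →L[ℝ] SModel m × ℝ) := by
    intro t
    have h1 : HasMFDerivAt 𝓘(ℝ, ℝ) 𝓘(ℝ, Fin m → ℂ) (fun s : ℝ => s • u) t
        ((1 : ℝ →L[ℝ] ℝ).smulRight u) := by
      have : HasFDerivAt (fun s : ℝ => s • u) ((1 : ℝ →L[ℝ] ℝ).smulRight u) t :=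
        (hasFDerivAt_id t).smul_const _
      exact this.hasMFDerivAt
    refine ((Y.mdifferentiableAt_orbit q (t • u)).hasMFDerivAt.comp t h1).congr_mfderiv
      (ContinuousLinearMap.ext fun a => ?_)
    have h2 : mfderiv 𝓘(ℝ, Fin m → ℂ) (coneI m) (Y.orbit q) (t • u) u = 0 := by
      rw [Y.mfderiv_orbit]
      refine (Y.gen_translate_base q (t • u) u).trans ?_
      rw [hu]
      exact (mfderiv (coneI m) (coneI m) (Y.translate (t • u)) q).map_zero
    refine ((mfderiv 𝓘(ℝ, Fin m → ℂ) (coneI m) (Y.orbit q) (t • u)).map_smul a u).trans ?_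
    rw [h2]
    exact smul_zero (M := ℝ) (A := SModel m × ℝ) a
  have hconst : ∀ t : ℝ, expC (t • u) = 1 := by
    intro t
    have h1 := eq_of_mfderiv_eq_zero (I := coneI m) (fun t => (hder t).mdifferentiableAt)
      (fun t => (hder t).mfderiv) t 0
    have h2 : Y.act (expC (t • u) * expC z) Y.base = Y.act (expC z) Y.base := by
      rw [← expC_add]
      change Y.translate (t • u + z) Y.base = q
      rw [Y.translate_add]
      simp only [zero_smul, Y.orbit_zero] at h1
      exact h1
    have h3 := Y.free_base h2
    exact mul_eq_right.1 h3
  ext k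
  have h4 : HasDerivAt (fun t : ℝ => Complex.exp ((t : ℂ) * u k)) (u k) 0 := by
    have h := (((Complex.ofRealCLM.hasDerivAt (x := (0 : ℝ))).mul_const (u k))).cexp
    simpa using h
  have h5 : (fun t : ℝ => Complex.exp ((t : ℂ) * u k)) = fun _ => 1 := by
    ext1 t
    have h := congrArg (fun w : Fin m → ℂˣ => ((w k : ℂˣ) : ℂ)) (hconst t)
    simpa [expC] using h
  rw [h5] at h4
  exact h4.unique (hasDerivAt_const 0 1)

theorem gen_bijective (hm : 1 ≤ m) (Y : ToricCone X) (z : Fin m → ℂ) :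
    Function.Bijective (Y.gen (Y.orbit Y.base z)) := by
  refine ⟨Y.gen_injective z, ?_⟩
  let L : (Fin m → ℂ) →ₗ[ℝ] SModel m × ℝ :=
    (show (Fin m → ℂ) →L[ℝ] SModel m × ℝ from Y.gen (Y.orbit Y.base z)).toLinearMap
  have hfin : Module.finrank ℝ (Fin m → ℂ) = Module.finrank ℝ (SModel m × ℝ) := by
    rw [finrank_cone hm, Module.finrank_pi_fintype]
    simp [mul_comm]
  exact (LinearMap.injective_iff_surjective_of_finrank_eq_finrank (f := L) hfin).1
    (Y.gen_injective z)

theorem exists_orbit_base (Y : ToricCone X) {p : Cone S}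
    (hp : p ∈ Set.range fun w => Y.act w Y.base) : ∃ z, p = Y.orbit Y.base z := by
  obtain ⟨w, rfl⟩ := hp
  refine ⟨fun k => Complex.log (w k), ?_⟩
  simp only [orbit]
  congr 2
  ext k
  simp [expC, Complex.exp_log (w k).ne_zero]

/-- The pullback of the Kähler form by an orbit map scales under the complexified action. -/
theorem kahlerBilin_gen_translate (Y : ToricCone X) (s : ℝ) (y : Fin m → ℝ) (p : Cone S)
    (u v : Fin m → ℂ) :
    kahlerBilin X (Y.translate (s • toC X.reeb + Complex.I • toC y) p)
        (Y.gen (Y.translate (s • toC X.reeb + Complex.I • toC y) p) u)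
        (Y.gen (Y.translate (s • toC X.reeb + Complex.I • toC y) p) v)
      = Real.exp s ^ 2 * kahlerBilin X p (Y.gen p u) (Y.gen p v) := by
  rw [Y.gen_translate_base, Y.gen_translate_base]
  exact Y.kahlerForm_translate s y p _ _

/-- The orbits of the torus in the open orbit are isotropic. -/
theorem kahlerBilin_gen_I_smul (hm : 1 ≤ m) (Y : ToricCone X) (z : Fin m → ℂ) (a b : Fin m → ℝ) :
    kahlerBilin X (Y.orbit Y.base z) (Y.gen (Y.orbit Y.base z) (Complex.I • toC a))
      (Y.gen (Y.orbit Y.base z) (Complex.I • toC b)) = 0 := by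
  let P : (Fin m → ℂ) → (Fin m → ℂ) → (Fin m → ℂ) → ℝ := fun x v w =>
    kahlerBilin X (Y.orbit Y.base x) (Y.gen (Y.orbit Y.base x) v) (Y.gen (Y.orbit Y.base x) w)
  -- The identity dω = 0 is evaluated on (ξ, i a, i b). The derivatives along i a and i b vanish by
  -- torus invariance, and the derivative along ξ is 2 ω(i a, i b), since ω is homogeneous of degree
  -- 2; so ω(i a, i b) = 0.
  have hclosed := X.closed Set.univ (Y.orbit Y.base) isOpen_univ
    (Y.contMDiff_orbit Y.base).contMDiffOn (fun x _ => by
      have h := Y.gen_bijective hm x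
      have e : ⇑(mfderiv 𝓘(ℝ, Fin m → ℂ) (coneI m) (Y.orbit Y.base) x)
        = ⇑(Y.gen (Y.orbit Y.base x)) := funext fun u => Y.mfderiv_orbit Y.base x u
      rw [e]; exact h) z (mem_univ z) (toC X.reeb) (Complex.I • toC a) (Complex.I • toC b)
  have hpull : ∀ v w : Fin m → ℂ, (fun x => coneMetric X.g (Y.orbit Y.base x)
      (X.J (Y.orbit Y.base x) (mfderiv 𝓘(ℝ, Fin m → ℂ) (coneI m) (Y.orbit Y.base) x v))
      (mfderiv 𝓘(ℝ, Fin m → ℂ) (coneI m) (Y.orbit Y.base) x w)) = fun x => P x v w := by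
    intro v w
    ext1 x
    rw [Y.mfderiv_orbit, Y.mfderiv_orbit]
    rfl
  simp only [hpull] at hclosed
  have hscale : ∀ (s : ℝ) (y : Fin m → ℝ) (v w : Fin m → ℂ),
      P (z + (s • toC X.reeb + Complex.I • toC y)) v w = Real.exp s ^ 2 * P z v w := by
    intro s y v w
    simp only [P]
    rw [add_comm z, Y.orbit_add]
    exact Y.kahlerBilin_gen_translate s y _ v w
  have himag : ∀ (y : Fin m → ℝ) (v w : Fin m → ℂ),
      fderiv ℝ (fun x => P x v w) z (Complex.I • toC y) = 0 := by
    intro y v w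
    refine fderiv_apply_eq_zero_of_const fun t => ?_
    have h := hscale 0 (t • y) v w
    rw [zero_smul, zero_add, toC_smul, Real.exp_zero, one_pow, one_mul, smul_comm] at h
    exact h
  -- Unlike the two vanishing derivatives, the derivative along ξ is a nontrivial directional
  -- derivative, which equals `fderiv` only if the function is differentiable.
  have hdiff : DifferentiableAt ℝ (fun x => P x (Complex.I • toC a) (Complex.I • toC b)) z := by
    have h := contDiffOn_coneMetric_mfderiv X.g isOpen_univ
      (Y.contMDiff_orbit Y.base).contMDiffOn (Complex.I • Complex.I • toC a) (Complex.I • toC b)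
    refine ((h.contDiffAt (Filter.univ_mem)).differentiableAt (by simp)).congr_of_eventuallyEq
      (Filter.Eventually.of_forall fun x => ?_)
    simp only [P]
    rw [Y.mfderiv_orbit, Y.mfderiv_orbit, Y.gen_I_smul _ (Complex.I • toC a)]
    rfl
  have hreeb : fderiv ℝ (fun x => P x (Complex.I • toC a) (Complex.I • toC b)) z (toC X.reeb)
      = 2 * P z (Complex.I • toC a) (Complex.I • toC b) := by
    rw [← hdiff.lineDeriv_eq_fderiv, lineDeriv]
    have h1 : (fun t : ℝ => P (z + t • toC X.reeb) (Complex.I • toC a) (Complex.I • toC b))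
        = fun t : ℝ => Real.exp t ^ 2 * P z (Complex.I • toC a) (Complex.I • toC b) := by
      ext1 t
      have h := hscale t 0 (Complex.I • toC a) (Complex.I • toC b)
      rw [show toC (0 : Fin m → ℝ) = 0 by ext; simp [toC], smul_zero, add_zero] at h
      exact h
    rw [h1]
    simp
  rw [hreeb, himag, himag] at hclosed
  change P z (Complex.I • toC a) (Complex.I • toC b) = 0
  linarith

end ToricCone

end

/-! ### The antiholomorphic involution is an isometry -/

theorem toC_re_add_im {m : ℕ} (u : Fin m → ℂ) :
    u = toC (fun k => (u k).re) + Complex.I • toC (fun k => (u k).im) := by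
  ext k
  simp [toC, mul_comm Complex.I, Complex.re_add_im]

theorem star_toC_add {m : ℕ} (a b : Fin m → ℝ) :
    star (toC a + Complex.I • toC b) = toC a - Complex.I • toC b := by
  ext k
  simp [toC, sub_eq_add_neg]

theorem coneMetric_neg_left {m : ℕ} {S : Type*} [TopologicalSpace S] [ChartedSpace (SModel m) S]
    [IsManifold 𝓘(ℝ, SModel m) ∞ S]
    (g : Bundle.ContMDiffRiemannianMetric 𝓘(ℝ, SModel m) ∞ (SModel m)
      (fun x : S => TangentSpace 𝓘(ℝ, SModel m) x)) (p : Cone S) (v w : TangentSpace (coneI m) p) :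
    coneMetric g p (-v) w = -coneMetric g p v w := by
  rw [← coneMetricForm_apply, map_neg, LinearMap.neg_apply, coneMetricForm_apply]

theorem expC_star {m : ℕ} (z : Fin m → ℂ) : expC (star z) = star (expC z) := by
  ext k
  simp [expC, Complex.exp_conj]

section

variable {m : ℕ} {S : Type*} [TopologicalSpace S] [ChartedSpace (SModel m) S]
  [IsManifold 𝓘(ℝ, SModel m) ∞ S] {X : ToricSasakiManifold m S}

namespace ToricCone

/-- Imaginary directions are isotropic, and by J-invariance so are the real ones. Only the mixed
terms remain, and conjugation changes the sign of exactly one factor in each. -/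
theorem kahlerBilin_gen_star (hm : 1 ≤ m) (Y : ToricCone X) (z u v : Fin m → ℂ) :
    kahlerBilin X (Y.orbit Y.base z) (Y.gen (Y.orbit Y.base z) (star u))
        (Y.gen (Y.orbit Y.base z) (star v))
      = -kahlerBilin X (Y.orbit Y.base z) (Y.gen (Y.orbit Y.base z) u)
        (Y.gen (Y.orbit Y.base z) v) := by
  have h1 := Y.kahlerBilin_gen_I_smul hm z
  have h2 : ∀ a b : Fin m → ℝ, kahlerBilin X (Y.orbit Y.base z)
      (Y.gen (Y.orbit Y.base z) (toC a)) (Y.gen (Y.orbit Y.base z) (toC b)) = 0 := by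
    intro a b
    have h := h1 a b
    rwa [Y.gen_I_smul, Y.gen_I_smul, kahlerBilin_J] at h
  rw [toC_re_add_im u, toC_re_add_im v, star_toC_add, star_toC_add]
  simp only [map_add, map_sub, LinearMap.add_apply, LinearMap.sub_apply, h1, h2]
  ring

theorem σ_translate (Y : ToricCone X) (z : Fin m → ℂ) (p : Cone S) :
    Y.σ (Y.translate z p) = Y.translate (star z) (Y.σ p) := by
  rw [translate, Y.σ_act, ← expC_star]; rfl

theorem σ_orbit_base (Y : ToricCone X) (z : Fin m → ℂ) :
    Y.σ (Y.orbit Y.base z) = Y.orbit Y.base (star z) := by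
  have h := Y.σ_translate z Y.base
  rw [Y.σ_base] at h
  exact h

theorem mdifferentiableAt_σ (Y : ToricCone X) (p : Cone S) :
    MDifferentiableAt (coneI m) (coneI m) Y.σ p := (Y.smooth_σ p).mdifferentiableAt (by simp)

theorem mfderiv_σ_gen (Y : ToricCone X) (p : Cone S) (u : Fin m → ℂ) :
    mfderiv (coneI m) (coneI m) Y.σ p (Y.gen p u) = Y.gen (Y.σ p) (star u) := by
  have h1 : Y.σ ∘ Y.orbit p = Y.orbit (Y.σ p) ∘ star := by
    ext1 w
    exact Y.σ_translate w p
  have h2 : HasMFDerivAt 𝓘(ℝ, Fin m → ℂ) 𝓘(ℝ, Fin m → ℂ) star (0 : Fin m → ℂ)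
      ((starL' ℝ : (Fin m → ℂ) ≃L[ℝ] (Fin m → ℂ)) : (Fin m → ℂ) →L[ℝ] (Fin m → ℂ)) :=
    (starL' ℝ : (Fin m → ℂ) ≃L[ℝ] (Fin m → ℂ)).hasFDerivAt.hasMFDerivAt
  have h3 := HasMFDerivAt.comp 0 (Y.hasMFDerivAt_orbit_of_eq_zero (Y.σ p) (star_zero _)) h2
  have h4 := (Y.mdifferentiableAt_σ (Y.orbit p 0)).hasMFDerivAt.comp 0
    (Y.mdifferentiableAt_orbit p 0).hasMFDerivAt
  rw [← h1] at h3
  have h5 : mfderiv (coneI m) (coneI m) Y.σ (Y.orbit p 0) (Y.gen p u : SModel m × ℝ)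
      = (Y.gen (Y.σ p) (star u) : SModel m × ℝ) :=
    congrArg (fun B : (Fin m → ℂ) →L[ℝ] SModel m × ℝ => B u) (hasMFDerivAt_unique h4 h3)
  rw [Y.orbit_zero] at h5
  exact h5

/-- The antiholomorphic involution is an isometry at the points of the open orbit. -/
theorem coneMetric_σ_orbit (hm : 1 ≤ m) (Y : ToricCone X) (z : Fin m → ℂ)
    (v w : TangentSpace (coneI m) (Y.orbit Y.base z)) :
    coneMetric X.g (Y.σ (Y.orbit Y.base z))
        (mfderiv (coneI m) (coneI m) Y.σ (Y.orbit Y.base z) v)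
        (mfderiv (coneI m) (coneI m) Y.σ (Y.orbit Y.base z) w)
      = coneMetric X.g (Y.orbit Y.base z) v w := by
  obtain ⟨u, rfl⟩ := (Y.gen_bijective hm z).2 v
  obtain ⟨u', rfl⟩ := (Y.gen_bijective hm z).2 w
  rw [Y.mfderiv_σ_gen, Y.mfderiv_σ_gen, ← kahlerBilin_J_right, ← kahlerBilin_J_right,
    ← Y.gen_I_smul, ← Y.gen_I_smul, Y.σ_orbit_base]
  -- The metric is written as ω(·, J ·). Conjugation anticommutes with i, and this sign cancels the
  -- one from `kahlerBilin_gen_star`.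
  have h1 : Complex.I • star u' = star (-(Complex.I • u')) := by
    ext k; simp
  rw [h1, Y.kahlerBilin_gen_star hm, map_neg, map_neg, neg_neg]
  -- The conjugate point differs from the original one by an element of the compact torus, which
  -- preserves ω.
  have h2 : star z = (0 : ℝ) • toC X.reeb + Complex.I • toC (fun k => -2 * (z k).im) + z := by
    ext k
    apply Complex.ext <;> simp [toC]
    ring
  have h3 := Y.kahlerBilin_gen_translate 0 (fun k => -2 * (z k).im) (Y.orbit Y.base z) u
    (Complex.I • u')
  rw [← Y.orbit_add, ← h2, Real.exp_zero, one_pow, one_mul] at h3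
  exact h3

/-- The antiholomorphic involution is an isometry. -/
theorem coneMetric_σ (hm : 1 ≤ m) (Y : ToricCone X) (p : Cone S)
    (v w : TangentSpace (coneI m) p) :
    coneMetric X.g (Y.σ p) (mfderiv (coneI m) (coneI m) Y.σ p v)
      (mfderiv (coneI m) (coneI m) Y.σ p w) = coneMetric X.g p v w := by
  have h := eq_zero_of_dense Y.dense_orbit (ι := Fin 2) (F := ℝ)
    (fun p v => coneMetric X.g (Y.σ p) (mfderiv (coneI m) (coneI m) Y.σ p (v 0))
      (mfderiv (coneI m) (coneI m) Y.σ p (v 1)) - coneMetric X.g p (v 0) (v 1)) ?_ ?_ p ![v, w]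
  · exact sub_eq_zero.1 h
  · intro V Φ hV hΦ v
    have h1 := contDiffOn_coneMetric_mfderiv X.g hV (Y.smooth_σ.comp_contMDiffOn hΦ) (v 0) (v 1)
    have h2 := contDiffOn_coneMetric_mfderiv X.g hV hΦ (v 0) (v 1)
    refine ((h1.sub h2).continuousOn).congr fun x hx => ?_
    have h3 := ((Y.mdifferentiableAt_σ (Φ x)).hasMFDerivAt.comp x
      ((hΦ.contMDiffAt (hV.mem_nhds hx)).mdifferentiableAt (by simp)).hasMFDerivAt).mfderiv
    exact (congrArg (fun B : SModel m × ℝ →L[ℝ] SModel m × ℝ =>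
      coneMetric X.g (Y.σ (Φ x)) (B (v 0)) (B (v 1)) - coneMetric X.g (Φ x)
        (mfderiv 𝓘(ℝ, SModel m × ℝ) (coneI m) Φ x (v 0))
        (mfderiv 𝓘(ℝ, SModel m × ℝ) (coneI m) Φ x (v 1))) h3).symm
  · intro p hp v
    obtain ⟨z, rfl⟩ := Y.exists_orbit_base hp
    exact sub_eq_zero.2 (Y.coneMetric_σ_orbit hm z _ _)

/-- The real form is isotropic. -/
theorem kahlerBilin_eq_zero_of_fixed (hm : 1 ≤ m) (Y : ToricCone X) {p : Cone S} (hp : Y.σ p = p)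
    {v w : TangentSpace (coneI m) p}
    (hv : (mfderiv (coneI m) (coneI m) Y.σ p v : SModel m × ℝ) = v)
    (hw : (mfderiv (coneI m) (coneI m) Y.σ p w : SModel m × ℝ) = w) :
    kahlerBilin X p v w = 0 := by
  -- Applying σ to ḡ(Jv, w) preserves it, but also replaces Jv by -Jv while fixing w, so it is its
  -- own negative.
  have h1 := Y.coneMetric_σ hm p (X.J p v) w
  rw [Y.antiholomorphic_σ] at h1
  have key : ∀ q (_ : q = p) (v' w' : SModel m × ℝ), v' = v → w' = w →
      coneMetric X.g q (-X.J q v') w' = -coneMetric X.g p (X.J p v) w := by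
    rintro q rfl _ _ rfl rfl
    exact coneMetric_neg_left X.g _ _ _
  rw [key _ hp _ _ hv hw] at h1
  change coneMetric X.g p (X.J p v) w = 0
  linarith

/-! ### Equivariance and reality of the canonical form -/

variable {γ : Fin m → ℤ} {Ω : ∀ p : Cone S, TangentSpace (coneI m) p [⋀^Fin m]→ₗ[ℝ] ℂ}

theorem IsCanonicalForm.apply_gen {Y : ToricCone X} (hΩ : Y.IsCanonicalForm γ Ω) (z : Fin m → ℂ)
    (u : Fin m → Fin m → ℂ) :
    Ω (Y.orbit Y.base z) (fun j => Y.gen (Y.orbit Y.base z) (u j))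
      = Complex.exp (∑ k, (γ k : ℂ) * z k) * Matrix.det (Matrix.of u) := by
  rw [← hΩ.2 z u]
  congr 1
  ext1 j
  exact (Y.mfderiv_orbit Y.base z (u j)).symm

omit [IsManifold 𝓘(ℝ, SModel m) ∞ S] in
theorem continuousOn_volumeForm_comp {J : ∀ p : Cone S, TangentSpace (coneI m) p →L[ℝ] TangentSpace (coneI m) p}
    (hΩ : IsHolomorphicVolumeForm J Ω) {G : Cone S → Cone S}
    (hG : ContMDiff (coneI m) (coneI m) ∞ G) {V : Set (SModel m × ℝ)} (hV : IsOpen V)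
    {Φ : SModel m × ℝ → Cone S} (hΦ : ContMDiffOn 𝓘(ℝ, SModel m × ℝ) (coneI m) ∞ Φ V)
    (v : Fin m → SModel m × ℝ) :
    ContinuousOn (fun x => Ω (G (Φ x)) fun j => mfderiv (coneI m) (coneI m) G (Φ x)
      (mfderiv 𝓘(ℝ, SModel m × ℝ) (coneI m) Φ x (v j))) V := by
  refine (continuousOn_volumeForm hΩ hV (hG.comp_contMDiffOn hΦ) v).congr fun x hx => ?_
  have h3 := (((hG (Φ x)).mdifferentiableAt (by simp)).hasMFDerivAt.comp x
    ((hΦ.contMDiffAt (hV.mem_nhds hx)).mdifferentiableAt (by simp)).hasMFDerivAt).mfderiv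
  exact (congrArg (fun B : SModel m × ℝ →L[ℝ] SModel m × ℝ =>
    Ω (G (Φ x)) fun j => B (v j)) h3).symm

/-- The canonical form is multiplied by a character under the action of the complex torus. -/
theorem IsCanonicalForm.apply_translate (hm : 1 ≤ m) {Y : ToricCone X}
    (hΩ : Y.IsCanonicalForm γ Ω) (w : Fin m → ℂ) (p : Cone S)
    (v : Fin m → TangentSpace (coneI m) p) :
    Ω (Y.translate w p) (fun j => mfderiv (coneI m) (coneI m) (Y.translate w) p (v j))
      = Complex.exp (∑ k, (γ k : ℂ) * w k) * Ω p v := by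
  have h := eq_zero_of_dense Y.dense_orbit (F := ℂ)
    (fun p v => Ω (Y.translate w p) (fun j => mfderiv (coneI m) (coneI m) (Y.translate w) p (v j))
      - Complex.exp (∑ k, (γ k : ℂ) * w k) * Ω p v) ?_ ?_ p v
  · exact sub_eq_zero.1 h
  · intro V Φ hV hΦ v
    exact (continuousOn_volumeForm_comp hΩ.1 (Y.contMDiff_translate w) hV hΦ v).sub
      (continuousOn_const.mul (continuousOn_volumeForm hΩ.1 hV hΦ v))
  · intro p hp v
    obtain ⟨z, rfl⟩ := Y.exists_orbit_base hp
    choose u hu using fun j => (Y.gen_bijective hm z).2 (v j)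
    obtain rfl : (fun j => Y.gen _ (u j)) = v := funext hu
    simp only [Y.mfderiv_translate_gen]
    rw [← Y.orbit_add, hΩ.apply_gen, hΩ.apply_gen, ← mul_assoc, ← Complex.exp_add,
      ← Finset.sum_add_distrib]
    simp only [Pi.add_apply, mul_add, sub_self]

/-- The canonical form is real with respect to the antiholomorphic involution. -/
theorem IsCanonicalForm.apply_σ (hm : 1 ≤ m) {Y : ToricCone X}
    (hΩ : Y.IsCanonicalForm γ Ω) (p : Cone S)
    (v : Fin m → TangentSpace (coneI m) p) :
    Ω (Y.σ p) (fun j => mfderiv (coneI m) (coneI m) Y.σ p (v j)) = star (Ω p v) := by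
  have h := eq_zero_of_dense Y.dense_orbit (F := ℂ)
    (fun p v => Ω (Y.σ p) (fun j => mfderiv (coneI m) (coneI m) Y.σ p (v j))
      - star (Ω p v)) ?_ ?_ p v
  · exact sub_eq_zero.1 h
  · intro V Φ hV hΦ v
    exact (continuousOn_volumeForm_comp hΩ.1 Y.smooth_σ hV hΦ v).sub
      (continuous_star.comp_continuousOn (continuousOn_volumeForm hΩ.1 hV hΦ v))
  · intro p hp v
    obtain ⟨z, rfl⟩ := Y.exists_orbit_base hp
    choose u hu using fun j => (Y.gen_bijective hm z).2 (v j)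
    obtain rfl : (fun j => Y.gen _ (u j)) = v := funext hu
    simp only [Y.mfderiv_σ_gen]
    rw [Y.σ_orbit_base, hΩ.apply_gen, hΩ.apply_gen, sub_eq_zero, star_mul', ← Matrix.det_conjTranspose,
      ← Matrix.det_transpose (Matrix.of u).conjTranspose]
    congr 1
    rw [Complex.star_def, ← Complex.exp_conj, map_sum]
    simp

theorem IsCanonicalForm.star_eq_of_fixed (hm : 1 ≤ m) {Y : ToricCone X}
    (hΩ : Y.IsCanonicalForm γ Ω) {p : Cone S} (hp : Y.σ p = p)
    {v : Fin m → TangentSpace (coneI m) p}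
    (hv : ∀ j, (mfderiv (coneI m) (coneI m) Y.σ p (v j) : SModel m × ℝ) = v j) :
    star (Ω p v) = Ω p v := by
  rw [← hΩ.apply_σ hm p v]
  have key : ∀ q (_ : q = p) (v' : Fin m → SModel m × ℝ), (∀ j, v' j = v j) →
      Ω q v' = Ω p v := by
    rintro q rfl v' h
    rw [show v' = v from funext h]
  exact key _ hp _ hv

end ToricCone

/-- Rescaling one direction by a complex number in a family of vectors that is linearly dependent
modulo that direction. -/
theorem volumeForm_add_smul {p : Cone S} (hΩ : IsHolomorphicVolumeForm X.J Ω)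
    {v : Fin m → TangentSpace (coneI m) p} (e : TangentSpace (coneI m) p) {c : Fin m → ℝ}
    {i : Fin m} (hi : c i ≠ 0) (hc : ∑ j, c j • v j = 0) (a : Fin m → ℝ) (β : ℂ) :
    Ω p (fun j => v j + a j • (β.re • e + β.im • X.J p e)) = β * Ω p (fun j => v j + a j • e) := by
  obtain ⟨U, φ, hpU, hφ, h, -, hform⟩ := hΩ p
  have hlin : ∀ x y : TangentSpace (coneI m) p, dC φ p (x + y) = dC φ p x + dC φ p y :=
    fun x y => (mfderiv (coneI m) 𝓘(ℝ, Fin m → ℂ) φ p).map_add x y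
  have hsm : ∀ (r : ℝ) (x : TangentSpace (coneI m) p), dC φ p (r • x) = r • dC φ p x :=
    fun r x => (mfderiv (coneI m) 𝓘(ℝ, Fin m → ℂ) φ p).map_smul r x
  have hrel : ∑ j, (c j : ℂ) • dC φ p (v j) = 0 := by
    have h1 : dC φ p (∑ j, c j • v j) = ∑ j, dC φ p (c j • v j) :=
      map_sum (mfderiv (coneI m) 𝓘(ℝ, Fin m → ℂ) φ p) _ _
    have h2 : dC φ p (0 : TangentSpace (coneI m) p) = 0 :=
      (mfderiv (coneI m) 𝓘(ℝ, Fin m → ℂ) φ p).map_zero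
    rw [hc, h2] at h1
    rw [h1]
    exact Finset.sum_congr rfl fun j _ => by rw [hsm]; exact (Complex.coe_smul _ _)
  have hdet := det_add_smul_of_relation (fun j => dC φ p (v j)) (fun j => (a j : ℂ)) (dC φ p e)
    (fun j => (c j : ℂ)) (i := i) (by exact_mod_cast hi) hrel β
  rw [(hform p hpU).2, (hform p hpU).2]
  -- In a holomorphic chart `J` is multiplication by i, so the vector β.re e + β.im J e has
  -- coordinates β dφ(e).
  have h1 : (Matrix.of fun j k => dC φ p (v j + a j • (β.re • e + β.im • X.J p e)) k)
      = Matrix.of fun j => dC φ p (v j) + ((a j : ℂ) * β) • dC φ p e := by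
    ext j k
    simp only [Matrix.of_apply, hlin, hsm, hφ.map_J p hpU, Pi.add_apply, Pi.smul_apply,
      smul_eq_mul, Complex.real_smul]
    conv_rhs => rw [← Complex.re_add_im β]
    ring
  have h2 : (Matrix.of fun j k => dC φ p (v j + a j • e) k)
      = Matrix.of fun j => dC φ p (v j) + (a j : ℂ) • dC φ p e := by
    ext j k
    simp only [Matrix.of_apply, hlin, hsm, Pi.add_apply, Pi.smul_apply, smul_eq_mul,
      Complex.real_smul]
  rw [h1, h2, hdet]
  ring

end

/-! ### The tangent space of the real form and of L -/

/-- The fixed space of an involution that anticommutes with a complex structure has half the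
dimension. -/
theorem finrank_eqLocus_of_anticommute {V : Type*} [AddCommGroup V] [Module ℝ V]
    [FiniteDimensional ℝ V] {m : ℕ} (hV : Module.finrank ℝ V = 2 * m) (A J : V →ₗ[ℝ] V)
    (hA : ∀ v, A (A v) = v) (hJ : ∀ v, J (J v) = -v) (hAJ : ∀ v, A (J v) = -J (A v)) :
    Module.finrank ℝ (LinearMap.eqLocus A LinearMap.id) = m := by
  set W := LinearMap.eqLocus A LinearMap.id with hW
  set N := LinearMap.eqLocus A (-LinearMap.id) with hN
  have hWm : ∀ v, v ∈ W ↔ A v = v := fun v => by simp [hW]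
  have hNm : ∀ v, v ∈ N ↔ A v = -v := fun v => by simp [hN]
  have hJi : Function.Injective J := fun v w h => by
    have := congrArg J h
    rw [hJ, hJ] at this
    exact neg_injective this
  -- Since `J` anticommutes with `A`, it maps each of the eigenspaces for ±1 injectively into the
  -- other; they have equal dimension and span `V`.
  have hWN : W.map J ≤ N := by
    rintro _ ⟨v, hv, rfl⟩
    rw [hNm, hAJ, (hWm v).1 hv]
  have hNW : N.map J ≤ W := by
    rintro _ ⟨v, hv, rfl⟩
    rw [hWm, hAJ, (hNm v).1 hv, map_neg, neg_neg]
  have h1 : Module.finrank ℝ W ≤ Module.finrank ℝ N := by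
    rw [(Submodule.equivMapOfInjective J hJi W).finrank_eq]
    exact Submodule.finrank_mono hWN
  have h2 : Module.finrank ℝ N ≤ Module.finrank ℝ W := by
    rw [(Submodule.equivMapOfInjective J hJi N).finrank_eq]
    exact Submodule.finrank_mono hNW
  have hcompl : IsCompl W N := by
    constructor
    · rw [Submodule.disjoint_def]
      intro v hv hv'
      have h : v = -v := ((hWm v).1 hv).symm.trans ((hNm v).1 hv')
      have h2 : (2 : ℝ) • v = 0 := by rw [two_smul]; exact add_eq_zero_iff_eq_neg.2 h
      simpa using h2
    · rw [codisjoint_iff, Submodule.eq_top_iff']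
      intro v
      rw [Submodule.mem_sup]
      refine ⟨(1 / 2 : ℝ) • (v + A v), ?_, (1 / 2 : ℝ) • (v - A v), ?_, by module⟩
      · rw [hWm, map_smul, map_add, hA, add_comm]
      · rw [hNm, map_smul, map_sub, hA, ← smul_neg, neg_sub]
  have h3 := Submodule.finrank_add_eq_of_isCompl hcompl
  omega

section

variable {m : ℕ} {S : Type*} [TopologicalSpace S] [ChartedSpace (SModel m) S]
  [IsManifold 𝓘(ℝ, SModel m) ∞ S] {X : ToricSasakiManifold m S}

namespace ToricCone

/-- The derivative of the antiholomorphic involution at a point. -/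
noncomputable def dσ (Y : ToricCone X) (p : Cone S) : SModel m × ℝ →ₗ[ℝ] SModel m × ℝ :=
  (show SModel m × ℝ →L[ℝ] SModel m × ℝ from mfderiv (coneI m) (coneI m) Y.σ p).toLinearMap

/-- The tangent vectors fixed by the derivative of the involution. -/
noncomputable def fixedTangent (Y : ToricCone X) (p : Cone S) : Submodule ℝ (SModel m × ℝ) :=
  LinearMap.eqLocus (Y.dσ p) LinearMap.id

theorem mem_fixedTangent (Y : ToricCone X) {p : Cone S} {v : SModel m × ℝ} :
    v ∈ Y.fixedTangent p ↔ (mfderiv (coneI m) (coneI m) Y.σ p v : SModel m × ℝ) = v := Iff.rfl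

theorem dσ_dσ (Y : ToricCone X) {p : Cone S} (hp : Y.σ p = p) (v : SModel m × ℝ) :
    Y.dσ p (Y.dσ p v) = v := by
  have h1 := (Y.mdifferentiableAt_σ (Y.σ p)).hasMFDerivAt.comp p
    (Y.mdifferentiableAt_σ p).hasMFDerivAt
  rw [show Y.σ ∘ Y.σ = id from funext Y.involutive_σ] at h1
  have h2 := congrArg (fun B : SModel m × ℝ →L[ℝ] SModel m × ℝ => B v)
    (hasMFDerivAt_unique h1 (hasMFDerivAt_id p))
  have h3 : Y.dσ (Y.σ p) (Y.dσ p v) = v := h2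
  rwa [hp] at h3

theorem finrank_fixedTangent (hm : 1 ≤ m) (Y : ToricCone X) {p : Cone S} (hp : Y.σ p = p) :
    Module.finrank ℝ (Y.fixedTangent p) = m := by
  refine finrank_eqLocus_of_anticommute (finrank_cone hm) (Y.dσ p)
    (show SModel m × ℝ →L[ℝ] SModel m × ℝ from X.J p).toLinearMap (Y.dσ_dσ hp)
    (fun v => J_sq X p v) (fun v => ?_)
  refine (Y.antiholomorphic_σ p v).trans ?_
  exact congrArg Neg.neg (J_congr X hp _)

theorem star_toC (v : Fin m → ℝ) : star (toC v) = toC v := by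
  ext k; simp [toC]

/-- The position vector is the generator of ξ, which is a real vector. -/
theorem position_mem_fixedTangent (Y : ToricCone X) {p : Cone S} (hp : Y.σ p = p) :
    (position m p : SModel m × ℝ) ∈ Y.fixedTangent p := by
  have h := Y.mfderiv_σ_gen p (toC X.reeb)
  rw [star_toC, Y.gen_reeb, Y.gen_reeb] at h
  refine h.trans ?_
  rw [hp]
  rfl

/-- Dilations are translations by real elements of the complex torus, and σ commutes with these. -/
theorem σ_dilate (Y : ToricCone X) (ρ : PosReal) (p : Cone S) :
    Y.σ (dilate ρ p) = dilate ρ (Y.σ p) := by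
  have h := Y.translate_smul_reeb (Real.log ρ)
  have e : (⟨Real.exp (Real.log ρ), Real.exp_pos _⟩ : PosReal) = ρ :=
    Subtype.ext (Real.exp_log ρ.2)
  rw [e] at h
  rw [← h, Y.σ_translate, ← toC_smul, star_toC]

theorem mem_realLevel_reeb (Y : ToricCone X) {c : ℝ} {p : Cone S} :
    p ∈ Y.realLevel X.reeb c ↔ Y.σ p = p ∧ 1 / 2 * (p.2 : ℝ) ^ 2 = c := by
  rw [← Y.pairing_moment_reeb p]; rfl

/-- The tangent vectors of `L` are the pairs of a vector of the real form without radial component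
and a vector of the line. -/
theorem isTangentTo_lagDomain (Y : ToricCone X) {c : ℝ} {I : Set ℝ} (hI : IsOpen I)
    {x : Cone S × ℝ} (hx : x ∈ Y.lagDomain X.reeb c I) (v : (SModel m × ℝ) × ℝ) :
    IsTangentTo (coneLineI m) (Y.lagDomain X.reeb c I) x v ↔
      v.1 ∈ Y.fixedTangent x.1 ∧ v.1.2 = 0 := by
  constructor
  · rintro ⟨ε, hε, k, hk, hkL, rfl, hkv⟩
    have h0 : (0 : ℝ) ∈ Ioo (-ε) ε := ⟨by linarith, hε⟩
    have hnhds : Ioo (-ε) ε ∈ 𝓝 (0 : ℝ) := isOpen_Ioo.mem_nhds h0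
    have hkd : HasMFDerivAt 𝓘(ℝ, ℝ) (coneLineI m) k 0 (mfderiv 𝓘(ℝ, ℝ) (coneLineI m) k 0) :=
      ((hk.contMDiffAt hnhds).mdifferentiableAt (by simp)).hasMFDerivAt
    have h1 := (hasMFDerivAt_fst (I := coneI m) (I' := 𝓘(ℝ, ℝ)) (k 0)).comp 0 hkd
    have h2 := (Y.mdifferentiableAt_σ (k 0).1).hasMFDerivAt.comp 0 h1
    have h3 := (hasMFDerivAt_radius (m := m) (k 0).1).comp 0 h1
    -- Both equations defining L hold along the curve: it is fixed by σ, and its radius is constant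
    -- because a positive radius is determined by its square. Differentiating them gives the two
    -- conditions.
    have e1 : (Y.σ ∘ Prod.fst ∘ k) =ᶠ[𝓝 0] Prod.fst ∘ k := by
      filter_upwards [hnhds] with s hs
      exact ((Y.mem_realLevel_reeb).1 (hkL s hs).1).1
    have e2 : ((fun p : Cone S => (p.2 : ℝ)) ∘ Prod.fst ∘ k) =ᶠ[𝓝 0]
        fun _ => ((k 0).1.2 : ℝ) := by
      filter_upwards [hnhds] with s hs
      have a1 := ((Y.mem_realLevel_reeb).1 (hkL s hs).1).2
      have a2 := ((Y.mem_realLevel_reeb).1 (hkL 0 h0).1).2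
      have a3 : ((k s).1.2 : ℝ) ^ 2 = ((k 0).1.2 : ℝ) ^ 2 := by linarith
      exact (sq_eq_sq₀ (le_of_lt (k s).1.2.2) (le_of_lt (k 0).1.2.2)).1 a3
    have u1 := congrArg (fun B : ℝ →L[ℝ] SModel m × ℝ => B 1)
      (hasMFDerivAt_unique h2 (h1.congr_of_eventuallyEq e1))
    have u2 := congrArg (fun B : ℝ →L[ℝ] ℝ => B 1)
      (hasMFDerivAt_unique h3 ((hasMFDerivAt_const (I := 𝓘(ℝ, ℝ)) (I' := 𝓘(ℝ, ℝ))
        ((k 0).1.2 : ℝ) (0 : ℝ)).congr_of_eventuallyEq e2))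
    subst hkv
    exact ⟨u1, u2⟩
  · rintro ⟨hv1, hv2⟩
    obtain ⟨p, t⟩ := x
    obtain ⟨⟨u, b⟩, a⟩ := v
    obtain rfl : b = 0 := hv2
    obtain ⟨hp, ht⟩ := hx
    obtain ⟨hσp, hpc⟩ := (Y.mem_realLevel_reeb).1 hp
    obtain ⟨ε, hε, k, hk, hk0, hkσ, hkd⟩ := exists_curve_of_fixedPoints_manifold (I := coneI m)
      Y.smooth_σ Y.involutive_σ hσp (v := ((u, 0) : SModel m × ℝ)) hv1
    have hline : ∀ᶠ s in 𝓝 (0 : ℝ), t + s * a ∈ I := by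
      have : ContinuousAt (fun s : ℝ => t + s * a) 0 := by fun_prop
      exact this (hI.mem_nhds (by simpa using ht))
    obtain ⟨δ, hδ, hδI⟩ := Metric.eventually_nhds_iff_ball.1 hline
    have hsub : ∀ s ∈ Ioo (-(min ε δ)) (min ε δ), s ∈ Ioo (-ε) ε ∧ t + s * a ∈ I := by
      intro s hs
      have h1 := lt_min_iff.1 hs.2
      have h2 := min_le_left ε δ
      have h3 := min_le_right ε δ
      refine ⟨⟨by linarith [hs.1], h1.1⟩, hδI s ?_⟩
      rw [mem_ball_zero_iff, Real.norm_eq_abs, abs_lt]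
      exact ⟨by linarith [hs.1], h1.2⟩
    have hlind : HasFDerivAt (fun s : ℝ => t + s * a) ((1 : ℝ →L[ℝ] ℝ).smulRight a) 0 := by
      have h := ((hasDerivAt_id (0 : ℝ)).mul_const a).const_add t
      rw [one_mul] at h
      exact h.hasFDerivAt
    -- The curve `k` in the real form may leave the sphere, so its radius is replaced by that of
    -- `p`. This rescaling commutes with σ, and the velocity is unchanged because the radial
    -- component of `(u, 0)` is zero.
    refine ⟨min ε δ, lt_min hε hδ, fun s => (((k s).1, p.2), t + s * a), ?_, ?_, ?_, ?_⟩
    · refine ContMDiffOn.prodMk (ContMDiffOn.prodMk ?_ contMDiffOn_const) ?_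
      · exact (contMDiff_fst.comp_contMDiffOn hk).mono fun s hs => (hsub s hs).1
      · exact (contDiff_const.add (contDiff_id.mul contDiff_const)).contMDiff.contMDiffOn
    · intro s hs
      refine ⟨(Y.mem_realLevel_reeb).2 ⟨?_, hpc⟩, (hsub s hs).2⟩
      have hpos : (0 : ℝ) < p.2 / (k s).2 := div_pos p.2.2 (k s).2.2
      have e : (((k s).1, p.2) : Cone S) = dilate ⟨p.2 / (k s).2, hpos⟩ (k s) := by
        refine Prod.ext rfl (Subtype.ext ?_)
        exact (div_mul_cancel₀ _ (ne_of_gt (k s).2.2)).symm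
      change Y.σ ((k s).1, p.2) = ((k s).1, p.2)
      rw [e, Y.σ_dilate, hkσ s (hsub s hs).1]
    · simp only [hk0, zero_mul, add_zero]
    · have h1 := ((hasMFDerivAt_fst (I := 𝓘(ℝ, SModel m)) (I' := 𝓘(ℝ, ℝ)) (k 0)).comp 0 hkd)
      have h2 := (h1.prodMk (hasMFDerivAt_const (I := 𝓘(ℝ, ℝ)) (I' := 𝓘(ℝ, ℝ))
        p.2 (0 : ℝ))).prodMk hlind.hasMFDerivAt
      have h3 := congrArg (fun B : ℝ →L[ℝ] (SModel m × ℝ) × ℝ => B 1) h2.mfderiv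
      refine Eq.trans h3 ?_
      change (((1 : ℝ) • u, (0 : ℝ)), (1 : ℝ) • a) = ((u, (0 : ℝ)), a)
      rw [one_smul, one_smul]

/-- The tangent space of `L` has dimension `m`. -/
theorem exists_tangentSpace_lagDomain (hm : 1 ≤ m) (Y : ToricCone X) {p : Cone S}
    (hp : Y.σ p = p) :
    ∃ V : Submodule ℝ ((SModel m × ℝ) × ℝ), Module.finrank ℝ V = m ∧
      ∀ v, v ∈ V ↔ v.1 ∈ Y.fixedTangent p ∧ v.1.2 = 0 := by
  have hr : (p.2 : ℝ) ≠ 0 := ne_of_gt p.2.2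
  -- The tangent space of the real form splits as its part without radial component plus the line of
  -- r∂ᵣ. The map `T` sends r∂ᵣ to the unit vector of the factor `I`, so its image is the tangent
  -- space of L and has dimension m.
  let T : SModel m × ℝ →ₗ[ℝ] (SModel m × ℝ) × ℝ :=
    ((LinearMap.fst ℝ (SModel m) ℝ).prod 0).prod ((p.2 : ℝ)⁻¹ • LinearMap.snd ℝ (SModel m) ℝ)
  have hT : ∀ w, T w = ((w.1, 0), (p.2 : ℝ)⁻¹ * w.2) := fun w => rfl
  have hTi : Function.Injective T := by
    intro v w h
    rw [hT, hT] at h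
    simp only [Prod.mk.injEq, and_true] at h
    exact Prod.ext h.1 (mul_left_cancel₀ (inv_ne_zero hr) h.2)
  have hpos : ((0, (p.2 : ℝ)) : SModel m × ℝ) ∈ Y.fixedTangent p := Y.position_mem_fixedTangent hp
  refine ⟨(Y.fixedTangent p).map T, ?_, ?_⟩
  · rw [← (Submodule.equivMapOfInjective T hTi _).finrank_eq, Y.finrank_fixedTangent hm hp]
  · rintro ⟨⟨u, b⟩, a⟩
    constructor
    · rintro ⟨⟨w, d⟩, hw, hwT⟩
      rw [hT] at hwT
      simp only [Prod.mk.injEq] at hwT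
      obtain ⟨⟨rfl, rfl⟩, rfl⟩ := hwT
      refine ⟨?_, rfl⟩
      have := (Y.fixedTangent p).sub_mem hw ((Y.fixedTangent p).smul_mem ((p.2 : ℝ)⁻¹ * d) hpos)
      convert! this using 1
      ext1
      · simp
      · simp; field_simp; simp
    · rintro ⟨h1, h2⟩
      obtain rfl : b = 0 := h2
      refine ⟨(u, a * p.2), ?_, ?_⟩
      · have := (Y.fixedTangent p).add_mem h1 ((Y.fixedTangent p).smul_mem a hpos)
        simpa using this
      · rw [hT]
        simp only [Prod.mk.injEq, true_and]
        field_simp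

/-- Vectors of the real form without radial component are linearly dependent as soon as there
are `m` of them. -/
theorem exists_relation_of_fixedTangent (hm : 1 ≤ m) (Y : ToricCone X) {p : Cone S}
    (hp : Y.σ p = p) {u : Fin m → SModel m × ℝ} (hu : ∀ j, u j ∈ Y.fixedTangent p)
    (hu0 : ∀ j, (u j).2 = 0) : ∃ c : Fin m → ℝ, ∑ j, c j • u j = 0 ∧ ∃ i, c i ≠ 0 := by
  by_contra! hcon
  have hli : LinearIndependent ℝ u := by
    rw [Fintype.linearIndependent_iff]
    exact hcon
  let u' : Fin m → Y.fixedTangent p := fun j => ⟨u j, hu j⟩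
  have hli' : LinearIndependent ℝ u' :=
    LinearIndependent.of_comp (Y.fixedTangent p).subtype hli
  have : Nonempty (Fin m) := ⟨⟨0, hm⟩⟩
  -- If independent, the m vectors would span the whole tangent space of the real form, and r∂ᵣ
  -- would have zero radial component.
  have htop := hli'.span_eq_top_of_card_eq_finrank
    (by rw [Y.finrank_fixedTangent hm hp, Fintype.card_fin])
  have hle : Submodule.span ℝ (Set.range u')
      ≤ LinearMap.ker ((LinearMap.snd ℝ (SModel m) ℝ).comp (Y.fixedTangent p).subtype) := by
    rw [Submodule.span_le]
    rintro _ ⟨j, rfl⟩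
    exact hu0 j
  rw [htop] at hle
  have h := hle (Submodule.mem_top (x := ⟨_, Y.position_mem_fixedTangent hp⟩))
  exact (ne_of_gt p.2.2) h

end ToricCone

end

/-! ### The differential of F and the Lagrangian property -/

theorem expT_add {m : ℕ} (v w : Fin m → ℝ) : expT (v + w) = expT v * expT w := by
  ext k; simp [expT, Circle.exp_add]

section

variable {m : ℕ} {S : Type*} [TopologicalSpace S] [ChartedSpace (SModel m) S]
  [IsManifold 𝓘(ℝ, SModel m) ∞ S] {X : ToricSasakiManifold m S}

/-- The logarithm of the element `ρ(t) exp(f(t) ξ) exp(ν)` of the complex torus. -/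
noncomputable def logPath (X : ToricSasakiManifold m S) (f : ℝ → ℝ) (ρ : ℝ → PosReal)
    (ν : Fin m → ℝ) (t : ℝ) : Fin m → ℂ :=
  Real.log (ρ t) • toC X.reeb + Complex.I • toC (f t • X.reeb + ν)

/-- The tangent vector `u + a (κ r∂ᵣ + φ ξ)` of the cone. -/
noncomputable def combine (X : ToricSasakiManifold m S) (p : Cone S) (κ φ : ℝ)
    (v : (SModel m × ℝ) × ℝ) : TangentSpace (coneI m) p :=
  (show TangentSpace (coneI m) p from v.1)
    + v.2 • (κ • position m p + φ • X.J p (position m p))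

/-- Here ζ = ξ matters: the dilation by ρ is exp(log ρ · ξ), so dilation and rotation combine into
one translation by the complex torus. -/
theorem lagMap_eq_translate (Y : ToricCone X) (f : ℝ → ℝ) (ρ : ℝ → PosReal) (ν : Fin m → ℝ) :
    lagMap X X.reeb (expT ν) f ρ = fun x => Y.translate (logPath X f ρ ν x.2) x.1 := by
  ext1 x
  have e : (⟨Real.exp (Real.log (ρ x.2)), Real.exp_pos _⟩ : PosReal) = ρ x.2 :=
    Subtype.ext (Real.exp_log (ρ x.2).2)
  rw [logPath, Y.translate_add, Y.translate_smul_reeb, Y.translate_I_smul, e, expT_add]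
  rfl

section Path

variable {I : Set ℝ} (hI : IsOpen I) {f : ℝ → ℝ} (hf : ContDiffOn ℝ ∞ f I) {ρ : ℝ → PosReal}
  (hρ : ContDiffOn ℝ ∞ (fun t => (ρ t : ℝ)) I) (ν : Fin m → ℝ) {t : ℝ} (ht : t ∈ I)

include hρ in
theorem contDiffOn_log_radius : ContDiffOn ℝ ∞ (fun t => Real.log (ρ t)) I :=
  hρ.log fun t _ => ne_of_gt (ρ t).2

include hf hρ in
theorem contDiffOn_logPath : ContDiffOn ℝ ∞ (logPath X f ρ ν) I := by
  have h1 : ContDiffOn ℝ ∞ (fun t => Real.log (ρ t) • toC X.reeb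
      + (f t • (Complex.I • toC X.reeb) + Complex.I • toC ν)) I :=
    ((contDiffOn_log_radius hρ).smul contDiffOn_const).add
      ((hf.smul contDiffOn_const).add contDiffOn_const)
  refine h1.congr fun t _ => ?_
  rw [logPath, toC_add, toC_smul, smul_add, smul_comm Complex.I]

include hI hf hρ ht in
theorem hasDerivAt_logPath : HasDerivAt (logPath X f ρ ν)
    (deriv (fun t => Real.log (ρ t)) t • toC X.reeb
      + deriv f t • (Complex.I • toC X.reeb)) t := by
  have h1 := (((contDiffOn_log_radius hρ).contDiffAt (hI.mem_nhds ht)).differentiableAt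
    (by simp)).hasDerivAt
  have h2 := ((hf.contDiffAt (hI.mem_nhds ht)).differentiableAt (by simp)).hasDerivAt
  have h3 := (h1.smul_const (toC X.reeb)).add
    ((h2.smul_const (Complex.I • toC X.reeb)).add_const (Complex.I • toC ν))
  refine h3.congr_of_eventuallyEq (Filter.Eventually.of_forall fun t => ?_)
  simp only [logPath, toC_add, toC_smul, smul_add, smul_comm Complex.I, Pi.add_apply]

include hI hf hρ ht in
theorem contMDiffAt_lagMap (Y : ToricCone X) (p : Cone S) :
    ContMDiffAt (coneLineI m) (coneI m) ∞ (lagMap X X.reeb (expT ν) f ρ) (p, t) := by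
  rw [lagMap_eq_translate Y]
  have h1 : ContMDiffAt (coneLineI m) 𝓘(ℝ, Fin m → ℂ) ∞
      (fun x : Cone S × ℝ => logPath X f ρ ν x.2) (p, t) :=
    ContMDiffAt.comp (p, t)
      ((contDiffOn_logPath hf hρ ν).contDiffAt (hI.mem_nhds ht)).contMDiffAt contMDiffAt_snd
  exact (Y.smooth_act (logPath X f ρ ν t, p)).comp (p, t) (h1.prodMk contMDiffAt_fst)

-- The joint derivative of the action splits into a part in the point and a part in the torus
-- variable. The latter is the generator of (κ' + i f')ξ, which the translation carries along from
-- `p`; at `p` it equals κ' r∂ᵣ + f' J r∂ᵣ.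
include hI hf hρ ht in
theorem mfderiv_lagMap (Y : ToricCone X) (p : Cone S) (v : (SModel m × ℝ) × ℝ) :
    (mfderiv (coneLineI m) (coneI m) (lagMap X X.reeb (expT ν) f ρ) (p, t) v : SModel m × ℝ)
      = mfderiv (coneI m) (coneI m) (Y.translate (logPath X f ρ ν t)) p
        (combine X p (deriv (fun t => Real.log (ρ t)) t) (deriv f t) v) := by
  have h1 := (hasDerivAt_logPath (X := X) hI hf hρ ν ht).hasFDerivAt.hasMFDerivAt
  have h2 := h1.comp (p, t) (hasMFDerivAt_snd (I := coneI m) (I' := 𝓘(ℝ, ℝ)) (p, t))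
  have h3 := h2.prodMk (hasMFDerivAt_fst (I := coneI m) (I' := 𝓘(ℝ, ℝ)) (p, t))
  have h4 := HasMFDerivAt.comp (g := fun x : (Fin m → ℂ) × Cone S => Y.act (expC x.1) x.2) (p, t)
    ((Y.smooth_act (logPath X f ρ ν t, p)).mdifferentiableAt (by simp)).hasMFDerivAt h3
  set w' := deriv (fun t => Real.log (ρ t)) t • toC X.reeb + deriv f t • (Complex.I • toC X.reeb)
    with hw'
  have h5 := congrArg (fun B : (SModel m × ℝ) × ℝ →L[ℝ] SModel m × ℝ => B v) h4.mfderiv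
  rw [lagMap_eq_translate Y]
  refine Eq.trans h5 ?_
  have hlin : ∀ B : (Fin m → ℂ) × (SModel m × ℝ) →L[ℝ] SModel m × ℝ,
      B (v.2 • w', v.1) = v.2 • B (w', 0) + B (0, v.1) := by
    intro B
    rw [← map_smul, ← map_add]
    simp
  have h6 := hlin (mfderiv ((𝓘(ℝ, Fin m → ℂ)).prod (coneI m)) (coneI m)
    (fun x : (Fin m → ℂ) × Cone S => Y.act (expC x.1) x.2) (logPath X f ρ ν t, p))
  refine Eq.trans h6 ?_
  have h7 := (Y.mfderiv_orbit_eq (logPath X f ρ ν t) p w').symm.trans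
    ((Y.mfderiv_orbit p (logPath X f ρ ν t) w').trans
      (Y.mfderiv_translate_gen p (logPath X f ρ ν t) w').symm)
  have h8 := (Y.mfderiv_translate_eq (logPath X f ρ ν t) p v.1).symm
  have h9 : Y.gen p w' = deriv (fun t => Real.log (ρ t)) t • position m p
      + deriv f t • X.J p (position m p) := by
    rw [hw', map_add, map_smul, map_smul, Y.gen_I_smul, Y.gen_reeb]
  refine Eq.trans (congrArg₂ (fun a b : SModel m × ℝ => v.2 • a + b) h7 h8) ?_
  rw [h9]
  have hlin' : ∀ (B : SModel m × ℝ →L[ℝ] SModel m × ℝ) (y : SModel m × ℝ),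
      v.2 • B y + B v.1 = B (v.1 + v.2 • y) := by
    intro B y
    rw [map_add, map_smul, add_comm]
  exact hlin' (mfderiv (coneI m) (coneI m) (Y.translate (logPath X f ρ ν t)) p) _

end Path

theorem kahlerBilin_neg_symm (X : ToricSasakiManifold m S) (p : Cone S)
    (v w : TangentSpace (coneI m) p) : kahlerBilin X p v w = -kahlerBilin X p w v := by
  have h1 := kahlerBilin_J X p v w
  rw [kahlerBilin_J_right, coneMetric_symm] at h1
  rw [← h1, ← coneMetricForm_apply]
  have h2 : kahlerBilin X p w v = coneMetric X.g p (X.J p w) v := rfl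
  have h3 := X.compatible p w (X.J p v)
  rw [J_sq, ← coneMetricForm_apply, map_neg, coneMetricForm_apply] at h3
  rw [h2, coneMetricForm_apply, ← h3]

/-- Contracting ω with the Reeb field gives d(r²/2), so vectors tangent to the spheres are
ω-orthogonal to it. This is how the level condition enters the Lagrangian property. -/
theorem kahlerBilin_position_J (X : ToricSasakiManifold m S) (p : Cone S)
    (v : TangentSpace (coneI m) p) :
    kahlerBilin X p v (X.J p (position m p)) = (p.2 : ℝ) * tangentR v := by
  rw [kahlerBilin_J_right, coneMetric_symm, coneMetric_position_left]

/-- The Kähler form on pairs of vectors `u + a (κ r∂ᵣ + φ ξ)`, where `u` is tangent to the real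
form and has no radial component. -/
theorem kahlerBilin_add_smul (hm : 1 ≤ m) (Y : ToricCone X) {p : Cone S} (hp : Y.σ p = p)
    {u u' : TangentSpace (coneI m) p} (hu : (u : SModel m × ℝ) ∈ Y.fixedTangent p)
    (hu' : (u' : SModel m × ℝ) ∈ Y.fixedTangent p) (h0 : tangentR u = 0) (h0' : tangentR u' = 0)
    (a a' κ φ : ℝ) :
    kahlerBilin X p (u + a • (κ • position m p + φ • X.J p (position m p)))
      (u' + a' • (κ • position m p + φ • X.J p (position m p))) = 0 := by
  have hpos := Y.position_mem_fixedTangent hp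
  have e1 := Y.kahlerBilin_eq_zero_of_fixed hm hp hu hu'
  have e2 := Y.kahlerBilin_eq_zero_of_fixed hm hp hu hpos
  have e3 := Y.kahlerBilin_eq_zero_of_fixed hm hp hpos hu'
  have e4 := Y.kahlerBilin_eq_zero_of_fixed hm hp hpos hpos
  have e5 := kahlerBilin_position_J X p u
  have e6 := kahlerBilin_neg_symm X p (X.J p (position m p)) u'
  rw [kahlerBilin_position_J] at e6
  have e7 := kahlerBilin_neg_symm X p (X.J p (position m p)) (position m p)
  have e8 := kahlerBilin_J X p (position m p) (position m p)
  rw [e4] at e8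
  simp only [map_add, map_smul, LinearMap.add_apply, LinearMap.smul_apply, smul_eq_mul,
    e1, e2, e3, e4, e5, e6, e7, e8, h0, h0']
  ring

/-- Pairing with r∂ᵣ isolates the coefficient `a` whenever `φ` is nonzero; with `φ` = f' this gives
the immersion property. -/
theorem kahlerBilin_position_add_smul (hm : 1 ≤ m) (Y : ToricCone X) {p : Cone S}
    (hp : Y.σ p = p) {u : TangentSpace (coneI m) p}
    (hu : (u : SModel m × ℝ) ∈ Y.fixedTangent p) (a κ φ : ℝ) :
    kahlerBilin X p (position m p) (u + a • (κ • position m p + φ • X.J p (position m p)))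
      = a * (φ * (p.2 * p.2)) := by
  have hpos := Y.position_mem_fixedTangent hp
  have e1 := Y.kahlerBilin_eq_zero_of_fixed hm hp hpos hu
  have e2 := Y.kahlerBilin_eq_zero_of_fixed hm hp hpos hpos
  have e4 : tangentR (position m p) = (p.2 : ℝ) := rfl
  simp only [map_add, map_smul, smul_eq_mul, e1, e2, kahlerBilin_position_J, e4]
  ring

theorem eq_zero_of_mfderiv_translate (Y : ToricCone X) (s : ℝ) (y : Fin m → ℝ) {p : Cone S}
    {v : TangentSpace (coneI m) p}
    (h : mfderiv (coneI m) (coneI m) (Y.translate (s • toC X.reeb + Complex.I • toC y)) p v = 0) :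
    v = 0 := by
  have h1 := Y.coneMetric_translate s y p v v
  rw [h, ← coneMetricForm_apply, map_zero] at h1
  exact eq_zero_of_coneMetric_self X.g
    ((mul_eq_zero.1 h1.symm).resolve_left (pow_ne_zero 2 (Real.exp_ne_zero s)))

/-- The translation is a homothety, so isotropy and injectivity can be checked at `p` on the vectors
`combine`. No phase condition enters, which leaves only the Lagrangian angle to discuss in the
theorem. -/
theorem isLagrangian_lagMap (hm : 1 ≤ m) (Y : ToricCone X) (c : ℝ) {I : Set ℝ} (hI : IsOpen I)
    {f : ℝ → ℝ} (hf : ContDiffOn ℝ ∞ f I) (hf' : ∀ t ∈ I, deriv f t ≠ 0) {ρ : ℝ → PosReal}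
    (hρ : ContDiffOn ℝ ∞ (fun t => (ρ t : ℝ)) I) (ν : Fin m → ℝ) :
    IsLagrangian X.toSasakiManifold (Y.lagDomain X.reeb c I)
      (lagMap X X.reeb (expT ν) f ρ) := by
  rintro ⟨p, t⟩ hx
  have ht : t ∈ I := hx.2
  obtain ⟨hp, hpc⟩ := Y.mem_realLevel_reeb.1 hx.1
  have hr : (0 : ℝ) < p.2 := p.2.2
  refine ⟨?_, contMDiffAt_lagMap hI hf hρ ν ht Y p, ?_, ?_⟩
  · obtain ⟨V, hV, hVm⟩ := Y.exists_tangentSpace_lagDomain hm hp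
    exact ⟨V, hV, fun v => (hVm v).trans (Y.isTangentTo_lagDomain hI hx v).symm⟩
  · intro v hv hv0
    obtain ⟨h1, h2⟩ := (Y.isTangentTo_lagDomain hI hx v).1 hv
    have h3 := (mfderiv_lagMap hI hf hρ ν ht Y p v).symm.trans hv0
    have h4 := eq_zero_of_mfderiv_translate Y _ _ h3
    obtain ⟨u, a⟩ := v
    -- Pairing a kernel vector with r∂ᵣ gives a f' r² = 0, hence a = 0 and then u = 0.
    have h6 := kahlerBilin_position_add_smul hm Y hp h1 a (deriv (fun t => Real.log (ρ t)) t)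
      (deriv f t)
    have h7 : a * (deriv f t * (p.2 * p.2)) = 0 :=
      h6.symm.trans ((congrArg (kahlerBilin X p (position m p)) h4).trans (map_zero _))
    obtain rfl : a = 0 := (mul_eq_zero.1 h7).resolve_right
      (mul_ne_zero (hf' t ht) (mul_pos hr hr).ne')
    rw [combine, zero_smul, add_zero] at h4
    exact Prod.ext h4 rfl
  · intro v w hv hw
    obtain ⟨h1, h2⟩ := (Y.isTangentTo_lagDomain hI hx v).1 hv
    obtain ⟨h3, h4⟩ := (Y.isTangentTo_lagDomain hI hx w).1 hw
    have e1 := mfderiv_lagMap hI hf hρ ν ht Y p v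
    have e2 := mfderiv_lagMap hI hf hρ ν ht Y p w
    have e3 := Y.kahlerForm_translate (Real.log (ρ t)) (f t • X.reeb + ν) p
      (combine X p (deriv (fun t => Real.log (ρ t)) t) (deriv f t) v)
      (combine X p (deriv (fun t => Real.log (ρ t)) t) (deriv f t) w)
    have e4 := kahlerBilin_add_smul hm Y hp h1 h3 h2 h4 v.2 w.2
      (deriv (fun t => Real.log (ρ t)) t) (deriv f t)
    have e5 : lagMap X X.reeb (expT ν) f ρ (p, t) = Y.translate (logPath X f ρ ν t) p := by
      rw [lagMap_eq_translate Y]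
    have key : ∀ (q q' : Cone S) (_ : q = q') (a a' b b' : SModel m × ℝ), a = a' → b = b' →
        X.kahlerForm q' a' b' = 0 → X.kahlerForm q a b = 0 := by
      rintro q _ rfl a _ b _ rfl rfl h
      exact h
    refine key _ _ e5 _ _ _ _ e1 e2 (e3.trans ?_)
    exact (congrArg _ e4).trans (mul_zero _)

end

/-! ### The Lagrangian angle and the pulled back volume form -/

/-- A complex number is `± e^{iθ}` times its norm if and only if `e^{-iθ}` rotates it to the real
axis. -/
theorem exists_sign_iff_im_eq_zero (W : ℂ) (θ a s : ℝ) (hs : Real.exp a * s = ‖W‖) :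
    (∃ ε : ℂ, (ε = 1 ∨ ε = -1) ∧ W = ε * Complex.exp (Complex.I * θ + a) * s) ↔
      (Complex.exp (-(Complex.I * θ)) * W).im = 0 := by
  have hexp : Complex.exp (Complex.I * θ + a) * s = Complex.exp (Complex.I * θ) * (‖W‖ : ℂ) := by
    rw [Complex.exp_add, mul_assoc, ← hs]
    push_cast
    rfl
  have hunit : Complex.exp (-(Complex.I * θ)) * Complex.exp (Complex.I * θ) = 1 := by
    rw [← Complex.exp_add, neg_add_cancel, Complex.exp_zero]
  constructor
  · rintro ⟨ε, hε, hW⟩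
    rw [mul_assoc, hexp] at hW
    have h1 : Complex.exp (-(Complex.I * θ)) * W = ε * (‖W‖ : ℂ) := by
      calc Complex.exp (-(Complex.I * θ)) * W
          = Complex.exp (-(Complex.I * θ)) * (ε * (Complex.exp (Complex.I * θ) * (‖W‖ : ℂ))) := by
            rw [← hW]
        _ = ε * (Complex.exp (-(Complex.I * θ)) * Complex.exp (Complex.I * θ)) * (‖W‖ : ℂ) := by
            ring
        _ = ε * (‖W‖ : ℂ) := by rw [hunit, mul_one]
    rw [h1]
    rcases hε with rfl | rfl <;> simp
  · intro him
    set z := Complex.exp (-(Complex.I * θ)) * W with hz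
    have hnorm : ‖z‖ = ‖W‖ := by
      rw [hz, norm_mul, Complex.norm_exp]
      simp
    have hzre : z = (z.re : ℂ) := Complex.ext rfl (by simp [him])
    have habs : |z.re| = ‖W‖ := by
      rw [← hnorm, hzre, Complex.norm_real, Real.norm_eq_abs, Complex.ofReal_re]
    have hWz : W = Complex.exp (Complex.I * θ) * z := by
      rw [hz, ← mul_assoc, mul_comm (Complex.exp (Complex.I * θ)), hunit, one_mul]
    rcases abs_choice z.re with h | h
    · refine ⟨1, Or.inl rfl, ?_⟩
      rw [mul_assoc, hexp, one_mul, ← habs, h, ← hzre]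
      exact hWz
    · refine ⟨-1, Or.inr rfl, ?_⟩
      rw [mul_assoc, hexp, ← habs, h]
      push_cast
      rw [← hzre]
      linear_combination hWz

section

variable {m : ℕ} {S : Type*} [TopologicalSpace S] [ChartedSpace (SModel m) S]
  [IsManifold 𝓘(ℝ, SModel m) ∞ S] {X : ToricSasakiManifold m S}
  {Ω : ∀ p : Cone S, TangentSpace (coneI m) p [⋀^Fin m]→ₗ[ℝ] ℂ} {ψ : Cone S → ℝ}

/-- The Gram determinant of isotropic vectors determines the norm of the volume form. -/
theorem IsVolumeRatio.norm_sq_of_isotropic (hψ : IsVolumeRatio X.toSasakiManifold Ω ψ) {p : Cone S}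
    {v : Fin m → TangentSpace (coneI m) p} (hv : ∀ j k, X.kahlerForm p (v j) (v k) = 0) :
    Real.exp (2 * m * ψ p) * Matrix.det (Matrix.of fun j k => X.metric p (v j) (v k))
      = ‖Ω p v‖ ^ 2 := by
  have h := hψ p v
  have h1 : (Matrix.of fun j k => (X.metric p (v j) (v k) : ℂ)
      - Complex.I * (X.kahlerForm p (v j) (v k) : ℂ))
      = (Matrix.of fun j k => X.metric p (v j) (v k)).map Complex.ofRealHom := by
    ext j k
    simp [hv]
  rw [h1, ← RingHom.mapMatrix_apply, ← RingHom.map_det, Complex.ofRealHom_eq_coe] at h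
  exact_mod_cast h

theorem IsVolumeRatio.norm_of_isotropic (hψ : IsVolumeRatio X.toSasakiManifold Ω ψ) {p : Cone S}
    {v : Fin m → TangentSpace (coneI m) p} (hv : ∀ j k, X.kahlerForm p (v j) (v k) = 0) :
    Real.exp (m * ψ p)
      * Real.sqrt (Matrix.det (Matrix.of fun j k => X.metric p (v j) (v k))) = ‖Ω p v‖ := by
  have h := hψ.norm_sq_of_isotropic hv
  have h1 : Real.exp (m * ψ p) = Real.sqrt (Real.exp (2 * m * ψ p)) := by
    rw [show 2 * m * ψ p = m * ψ p + m * ψ p by ring, Real.exp_add,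
      Real.sqrt_mul_self (Real.exp_nonneg _)]
  rw [h1, ← Real.sqrt_mul (Real.exp_nonneg _), h, Real.sqrt_sq (norm_nonneg _)]

/-- A kernel vector `c` of the Gram matrix makes ∑ c_j v_j orthogonal to itself, hence zero by
positive definiteness. -/
theorem gram_det_ne_zero (X : ToricSasakiManifold m S) {p : Cone S}
    {v : Fin m → TangentSpace (coneI m) p}
    (hv : ∀ c : Fin m → ℝ, ∑ j, c j • v j = 0 → c = 0) :
    Matrix.det (Matrix.of fun j k => X.metric p (v j) (v k)) ≠ 0 := by
  intro h
  obtain ⟨c, hc, hc0⟩ := Matrix.exists_mulVec_eq_zero_iff.2 h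
  refine hc (hv c (eq_zero_of_coneMetric_self X.g ?_))
  rw [← coneMetricForm_apply, map_sum (coneMetricForm X.g p), LinearMap.sum_apply]
  refine Finset.sum_eq_zero fun j _ => ?_
  rw [map_smul, LinearMap.smul_apply, map_sum]
  have h1 := congrFun hc0 j
  simp only [Matrix.mulVec, dotProduct, Matrix.of_apply, Pi.zero_apply] at h1
  have h2 : ∑ k, (coneMetricForm X.g p (v j)) (c k • v k) = 0 := by
    rw [← h1]
    refine Finset.sum_congr rfl fun k _ => ?_
    rw [map_smul, smul_eq_mul, mul_comm]
    rfl
  rw [h2, smul_zero]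

/-- Under the Lagrangian condition, the Lagrangian angle is `θ` if and only if `e^{-iθ} F^* Ω` is
real. -/
theorem hasLagrangianAngle_iff (hψ : IsVolumeRatio X.toSasakiManifold Ω ψ)
    {L : Set (Cone S × ℝ)} {F : Cone S × ℝ → Cone S} (hF : IsLagrangian X.toSasakiManifold L F)
    {x : Cone S × ℝ} (hx : x ∈ L) (θ : ℝ) :
    HasLagrangianAngle X.toSasakiManifold Ω ψ L F x θ ↔
      ∀ v : Fin m → TangentSpace (coneLineI m) x, (∀ j, IsTangentTo (coneLineI m) L x (v j)) →
        (Complex.exp (-(Complex.I * θ))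
          * Ω (F x) (fun j => mfderiv (coneLineI m) (coneI m) F x (v j))).im = 0 := by
  refine forall_congr' fun v => forall_congr' fun hv => ?_
  -- On isotropic vectors ψ makes the moduli of the two sides agree, so only the argument modulo π
  -- is a condition.
  have h := hψ.norm_of_isotropic (p := F x)
    (v := fun j => mfderiv (coneLineI m) (coneI m) F x (v j))
    fun j k => (hF x hx).2.2.2 (v j) (v k) (hv j) (hv k)
  rw [← exists_sign_iff_im_eq_zero _ _ _ _ h]
  push_cast
  rfl

/-- A Lagrangian submanifold has tangent vectors on which the volume form does not vanish. -/
theorem IsLagrangian.exists_volumeForm_ne_zero (hψ : IsVolumeRatio X.toSasakiManifold Ω ψ)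
    {L : Set (Cone S × ℝ)} {F : Cone S × ℝ → Cone S} (hF : IsLagrangian X.toSasakiManifold L F)
    {x : Cone S × ℝ} (hx : x ∈ L) :
    ∃ v : Fin m → TangentSpace (coneLineI m) x, (∀ j, IsTangentTo (coneLineI m) L x (v j)) ∧
      Ω (F x) (fun j => mfderiv (coneLineI m) (coneI m) F x (v j)) ≠ 0 := by
  obtain ⟨⟨V, hV, hVm⟩, -, himm, hiso⟩ := hF x hx
  have hfin : FiniteDimensional ℝ (TangentSpace (coneLineI m) x) :=
    inferInstanceAs (FiniteDimensional ℝ ((SModel m × ℝ) × ℝ))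
  let b : Module.Basis (Fin m) ℝ V := Module.finBasisOfFinrankEq ℝ V hV
  refine ⟨fun j => b j, fun j => (hVm _).1 (b j).2, fun h0 => ?_⟩
  -- If Ω vanished on the image of a basis, the Gram determinant would vanish too, contradicting the
  -- immersion property.
  have h1 := hψ.norm_sq_of_isotropic (p := F x)
    (v := fun j => mfderiv (coneLineI m) (coneI m) F x (b j : TangentSpace (coneLineI m) x))
    fun j k => hiso _ _ ((hVm _).1 (b j).2) ((hVm _).1 (b k).2)
  rw [h0, norm_zero, zero_pow two_ne_zero] at h1
  refine gram_det_ne_zero X (fun c hc => ?_)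
    ((mul_eq_zero.1 h1).resolve_left (Real.exp_ne_zero _))
  have h2 : mfderiv (coneLineI m) (coneI m) F x
      ((∑ j, c j • b j : V) : TangentSpace (coneLineI m) x) = 0 := by
    rw [← hc, Submodule.coe_sum]
    refine (map_sum (mfderiv (coneLineI m) (coneI m) F x) _ _).trans ?_
    exact Finset.sum_congr rfl fun j _ =>
      (mfderiv (coneLineI m) (coneI m) F x).map_smul (c j) (b j : TangentSpace (coneLineI m) x)
  have h3 := himm _ ((hVm _).1 (∑ j, c j • b j : V).2) h2
  have h4 : (∑ j, c j • b j : V) = 0 := Subtype.ext h3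
  exact funext (Fintype.linearIndependent_iff.1 b.linearIndependent c h4)

/-- The volume form on tangent vectors of the image of `L`. -/
theorem exists_volumeForm_lagMap (hm : 1 ≤ m) {Y : ToricCone X} {γ : Fin m → ℤ}
    (hΩ : Y.IsCanonicalForm γ Ω) {c : ℝ} {I : Set ℝ} (hI : IsOpen I)
    {f : ℝ → ℝ} (hf : ContDiffOn ℝ ∞ f I) {ρ : ℝ → PosReal}
    (hρ : ContDiffOn ℝ ∞ (fun t => (ρ t : ℝ)) I) (ν : Fin m → ℝ)
    {x : Cone S × ℝ} (hx : x ∈ Y.lagDomain X.reeb c I)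
    {v : Fin m → TangentSpace (coneLineI m) x}
    (hv : ∀ j, IsTangentTo (coneLineI m) (Y.lagDomain X.reeb c I) x (v j)) :
    ∃ R : ℝ, Ω (lagMap X X.reeb (expT ν) f ρ x)
        (fun j => mfderiv (coneLineI m) (coneI m) (lagMap X X.reeb (expT ν) f ρ) x (v j))
      = Complex.exp (∑ k, (γ k : ℂ) * logPath X f ρ ν x.2 k)
        * (⟨deriv (fun t => Real.log (ρ t)) x.2, deriv f x.2⟩ * R) := by
  obtain ⟨p, t⟩ := x
  have ht : t ∈ I := hx.2
  obtain ⟨hp, -⟩ := Y.mem_realLevel_reeb.1 hx.1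
  have hvt := fun j => (Y.isTangentTo_lagDomain hI hx (v j)).1 (hv j)
  let u : Fin m → TangentSpace (coneI m) p := fun j => (show (SModel m × ℝ) × ℝ from v j).1
  let a : Fin m → ℝ := fun j => (show (SModel m × ℝ) × ℝ from v j).2
  obtain ⟨r, hr, i, hi⟩ := Y.exists_relation_of_fixedTangent hm hp (u := u)
    (fun j => (hvt j).1) (fun j => (hvt j).2)
  have hreal := hΩ.star_eq_of_fixed hm hp (v := fun j => u j + a j • position m p)
    fun j => (Y.fixedTangent p).add_mem (hvt j).1
      ((Y.fixedTangent p).smul_mem (a j) (Y.position_mem_fixedTangent hp))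
  -- The real factor is Ω on vectors tangent to the real form. The relation among the `u j` pulls
  -- out κ' + i f', and equivariance pulls out the exponential.
  refine ⟨(Ω p fun j => u j + a j • position m p).re, ?_⟩
  rw [Complex.conj_eq_iff_re.1 hreal,
    ← volumeForm_add_smul hΩ.1 (position m p) hi hr a
      ⟨deriv (fun t => Real.log (ρ t)) t, deriv f t⟩,
    ← hΩ.apply_translate hm]
  have key : ∀ (q q' : Cone S) (_ : q = q') (w w' : Fin m → SModel m × ℝ), (∀ j, w j = w' j) →
      Ω q w = Ω q' w' := by
    rintro q _ rfl w w' h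
    rw [show w = w' from funext h]
  refine key _ _ (by rw [lagMap_eq_translate Y]) _ _ fun j => ?_
  exact mfderiv_lagMap hI hf hρ ν ht Y p (v j)

/-! ### Positivity of N, nonempty levels, and the derivative of the phase function -/

/-- The pairing of `γ` with the Reeb vector is positive. -/
theorem pairing_reeb_pos (hm : 1 ≤ m) (Y : ToricCone X) {Λ : Set (Fin m → ℤ)}
    (hΛ : IsConormalSet Λ X.momentImage) {γ : Fin m → ℤ}
    (hγ : ∀ l ∈ Λ, ∑ k, γ k * l k = 1) : 0 < ∑ k, (γ k : ℝ) * X.reeb k := by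
  have hpos : ∀ y ∈ X.momentImage, 0 < pairing y X.reeb := by
    rintro _ ⟨p, rfl⟩
    have hr : (0 : ℝ) < p.2 := p.2.2
    rw [Y.pairing_moment_reeb]
    positivity
  -- If γ is nonzero it lies in the moment image, as it pairs to 1 with every conormal. If γ = 0,
  -- there are no conormals, so the moment image contains both y and -y for y ≠ 0, contradicting
  -- positivity of ξ on it.
  by_cases hγ0 : γ = 0
  · exfalso
    have hempty : ∀ l, l ∉ Λ := by
      intro l hl
      have := hγ l hl
      simp [hγ0] at this
    have hmem : ∀ y : Fin m → ℝ, y ≠ 0 → y ∈ X.momentImage := by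
      intro y hy
      rw [hΛ.eq]
      exact ⟨fun l hl => absurd hl (hempty l), hy⟩
    have hy : (fun _ => 1 : Fin m → ℝ) ≠ 0 := fun h => one_ne_zero (congrFun h ⟨0, hm⟩)
    have h1 := hpos _ (hmem _ hy)
    have h2 := hpos _ (hmem _ (neg_ne_zero.2 hy))
    simp only [pairing, Pi.neg_apply, neg_mul, Finset.sum_neg_distrib] at h1 h2
    linarith
  · have hmem : ofLattice γ ∈ X.momentImage := by
      rw [hΛ.eq]
      refine ⟨fun l hl => ?_, fun h => hγ0 ?_⟩
      · have h1 : pairing (ofLattice γ) (ofLattice l) = 1 := by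
          have := hγ l hl
          simp only [pairing, ofLattice]
          exact_mod_cast this
        rw [h1]
        exact zero_le_one
      · ext k
        have := congrFun h k
        simpa [ofLattice] using this
    exact hpos _ hmem

/-- Dilates of the base point stay in the real form, and their radius can be chosen freely. So L is
nonempty over each t, which the forward implication of the theorem needs. -/
theorem exists_mem_realLevel (Y : ToricCone X) {y : Fin m → ℝ} (hy : y ∈ X.momentImage) :
    ∃ p, p ∈ Y.realLevel X.reeb (pairing y X.reeb) := by
  obtain ⟨q, rfl⟩ := hy
  have hpos : (0 : ℝ) < q.2 / Y.base.2 := div_pos q.2.2 Y.base.2.2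
  refine ⟨dilate ⟨_, hpos⟩ Y.base, Y.mem_realLevel_reeb.2 ⟨?_, ?_⟩⟩
  · rw [Y.σ_dilate, Y.σ_base]
  · rw [Y.pairing_moment_reeb]
    change 1 / 2 * ((q.2 / Y.base.2 : ℝ) * Y.base.2) ^ 2 = _
    rw [div_mul_cancel₀ _ (ne_of_gt Y.base.2.2)]

end

/-- The derivative of `Im (A e^{N(κ + i f)})`. -/
theorem hasDerivAt_phase {κ f : ℝ → ℝ} {κ' f' t : ℝ} (hκ : HasDerivAt κ κ' t)
    (hf : HasDerivAt f f' t) (A : ℂ) (N : ℝ) :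
    HasDerivAt (fun t => (A * Complex.exp ((N : ℂ) * ((κ t : ℂ) + Complex.I * (f t : ℂ)))).im)
      (N * (A * Complex.exp ((N : ℂ) * ((κ t : ℂ) + Complex.I * (f t : ℂ))) * ⟨κ', f'⟩).im) t := by
  have h1 := (((hκ.ofReal_comp.add (hf.ofReal_comp.const_mul Complex.I)).const_mul
    (N : ℂ)).cexp).const_mul A
  have h2 := (Complex.imCLM.hasFDerivAt.comp_hasDerivAt t h1)
  refine h2.congr_deriv ?_
  have h3 : (⟨κ', f'⟩ : ℂ) = κ' + Complex.I * f' := by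
    rw [mul_comm]; exact Complex.mk_eq_add_mul_I _ _
  rw [h3, ← Complex.im_ofReal_mul, Complex.imCLM_apply]
  congr 1
  simp only [Pi.add_apply]
  ring

end ToricSasaki

/-! ### The main theorem -/

open ToricSasaki in
theorem mainTheorem3 (m : ℕ) (hm : 1 ≤ m)
    (S : Type*) [TopologicalSpace S] [T2Space S] [ChartedSpace (ToricSasaki.SModel m) S]
    [IsManifold 𝓘(ℝ, ToricSasaki.SModel m) ∞ S]
    (X : ToricSasaki.ToricSasakiManifold m S) (Y : ToricSasaki.ToricCone X)
    (Λ : Set (Fin m → ℤ)) (hΛ : ToricSasaki.IsConormalSet Λ X.momentImage)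
    (γ : Fin m → ℤ) (hγ : ∀ l ∈ Λ, ∑ k, γ k * l k = 1)
    (Ω : ∀ p : ToricSasaki.Cone S,
      TangentSpace (ToricSasaki.coneI m) p [⋀^Fin m]→ₗ[ℝ] ℂ)
    (hΩ : Y.IsCanonicalForm γ Ω)
    (ψ : ToricSasaki.Cone S → ℝ)
    (hψ : ToricSasaki.IsVolumeRatio X.toSasakiManifold Ω ψ)
    (ζ : Fin m → ℝ) (c : ℝ)
    (hint : (interior X.momentImage ∩ {y | ToricSasaki.pairing y ζ = c}).Nonempty)
    (hspan : ∀ y ∈ X.momentImage, ToricSasaki.pairing y ζ = c →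
      ζ ∉ ToricSasaki.conormalSpan Λ y)
    (I : Set ℝ) (hI : IsOpen I) (hIc : I.OrdConnected)
    (f : ℝ → ℝ) (hf : ContDiffOn ℝ ∞ f I) (hf' : ∀ t ∈ I, deriv f t ≠ 0)
    (ρ : ℝ → ToricSasaki.PosReal) (hρ : ContDiffOn ℝ ∞ (fun t => (ρ t : ℝ)) I)
    (ν : Fin m → ℝ)
    (hζ : ζ = X.reeb) (θ₀ : ℝ) :
    ToricSasaki.IsSpecialLagrangian X.toSasakiManifold Ω ψ (Y.lagDomain ζ c I)
        (ToricSasaki.lagMap X ζ (ToricSasaki.expT ν) f ρ) θ₀ ↔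
      ∃ C : ℝ, ∀ t ∈ I,
        (Complex.exp (Complex.I * (((∑ k, (γ k : ℝ) * ν k) - θ₀ : ℝ) : ℂ)) *
          Complex.exp (((∑ k, (γ k : ℝ) * ζ k : ℝ) : ℂ) *
            ((Real.log (ρ t) : ℂ) + Complex.I * (f t : ℂ)))).im = C := by
  subst hζ
  have hlag := isLagrangian_lagMap hm Y c hI hf hf' hρ ν
  set N : ℝ := ∑ k, (γ k : ℝ) * X.reeb k with hN
  have hNpos : 0 < N := pairing_reeb_pos hm Y hΛ hγ
  set A : ℂ := Complex.exp (Complex.I * (((∑ k, (γ k : ℝ) * ν k) - θ₀ : ℝ) : ℂ)) with hA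
  let Z : ℝ → ℂ := fun t => A * Complex.exp ((N : ℂ) * ((Real.log (ρ t) : ℂ)
    + Complex.I * (f t : ℂ)))
  let β : ℝ → ℂ := fun t => ⟨deriv (fun t => Real.log (ρ t)) t, deriv f t⟩
  -- The link between the two sides: up to the factor N, the derivative of the phase function is the
  -- imaginary part that decides the angle.
  have hder : ∀ t ∈ I, HasDerivAt (fun t => (Z t).im) (N * (Z t * β t).im) t := fun t ht =>
    hasDerivAt_phase (((contDiffOn_log_radius hρ).contDiffAt (hI.mem_nhds ht)).differentiableAt
      (by simp)).hasDerivAt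
      ((hf.contDiffAt (hI.mem_nhds ht)).differentiableAt (by simp)).hasDerivAt A N
  have hphase : ∀ t, Complex.exp (-(Complex.I * θ₀))
      * Complex.exp (∑ k, (γ k : ℂ) * logPath X f ρ ν t k) = Z t := by
    intro t
    simp only [Z, hA, ← Complex.exp_add, hN]
    congr 1
    have h1 : ∑ k, (γ k : ℂ) * logPath X f ρ ν t k
        = ∑ k, (((γ k : ℂ) * (X.reeb k : ℂ)) * ((Real.log (ρ t) : ℂ) + Complex.I * (f t : ℂ))
          + Complex.I * ((γ k : ℂ) * (ν k : ℂ))) := by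
      refine Finset.sum_congr rfl fun k _ => ?_
      simp only [logPath, toC, Pi.add_apply, Pi.smul_apply, smul_eq_mul, Complex.real_smul,
        Complex.ofReal_add, Complex.ofReal_mul]
      ring
    rw [h1, Finset.sum_add_distrib, ← Finset.sum_mul, ← Finset.mul_sum]
    push_cast
    ring
  have hangle : ∀ x ∈ Y.lagDomain X.reeb c I, ∀ v : Fin m → TangentSpace (coneLineI m) x,
      (∀ j, IsTangentTo (coneLineI m) (Y.lagDomain X.reeb c I) x (v j)) →
      ∃ R : ℝ, Complex.exp (-(Complex.I * θ₀)) * Ω (lagMap X X.reeb (expT ν) f ρ x)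
        (fun j => mfderiv (coneLineI m) (coneI m) (lagMap X X.reeb (expT ν) f ρ) x (v j))
        = R * (Z x.2 * β x.2) := by
    intro x hx v hv
    obtain ⟨R, hR⟩ := exists_volumeForm_lagMap hm hΩ hI hf hρ ν hx hv
    refine ⟨R, ?_⟩
    rw [hR, ← mul_assoc, hphase]
    ring
  constructor
  · rintro ⟨-, hsl⟩
    have hzero : ∀ t ∈ I, (Z t * β t).im = 0 := by
      intro t ht
      obtain ⟨y, hy, hyc⟩ := hint
      obtain ⟨p, hp⟩ := exists_mem_realLevel Y (interior_subset hy)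
      rw [show pairing y X.reeb = c from hyc] at hp
      have hx : (p, t) ∈ Y.lagDomain X.reeb c I := ⟨hp, ht⟩
      obtain ⟨v, hv, hv0⟩ := hlag.exists_volumeForm_ne_zero hψ hx
      have h1 := (hasLagrangianAngle_iff hψ hlag hx θ₀).1 (hsl _ hx) v hv
      obtain ⟨R, hR⟩ := hangle _ hx v hv
      -- The tangent vectors were chosen with nonzero Ω, so the real factor can be cancelled.
      have hR0 : R ≠ 0 := by
        rintro rfl
        rw [Complex.ofReal_zero, zero_mul] at hR
        exact (mul_ne_zero (Complex.exp_ne_zero _) hv0) hR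
      rw [hR, Complex.im_ofReal_mul] at h1
      exact (mul_eq_zero.1 h1).resolve_left hR0
    -- The interval is allowed to be empty; any constant then works.
    rcases I.eq_empty_or_nonempty with rfl | ⟨t₀, ht₀⟩
    · exact ⟨0, fun t ht => ht.elim⟩
    · refine ⟨(Z t₀).im, fun t ht => ?_⟩
      refine hI.is_const_of_deriv_eq_zero hIc.isPreconnected
        (fun s hs => (hder s hs).differentiableAt.differentiableWithinAt) (fun s hs => ?_) ht ht₀
      rw [(hder s hs).deriv, hzero s hs, mul_zero]
      rfl
  · rintro ⟨C, hC⟩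
    refine ⟨hlag, fun x hx => (hasLagrangianAngle_iff hψ hlag hx θ₀).2 fun v hv => ?_⟩
    obtain ⟨R, hR⟩ := hangle x hx v hv
    have ht : x.2 ∈ I := hx.2
    have hconst : HasDerivAt (fun t => (Z t).im) 0 x.2 :=
      (hasDerivAt_const x.2 C).congr_of_eventuallyEq
        (Filter.eventually_of_mem (hI.mem_nhds ht) fun t ht => hC t ht)
    have h1 := (hder x.2 ht).unique hconst
    -- Constancy gives N Im(Z β) = 0, and N > 0 is what yields Im(Z β) = 0.
    rw [hR, Complex.im_ofReal_mul, (mul_eq_zero.1 h1).resolve_left hNpos.ne', mul_zero]
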